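/- A constraint graph is an undirected graph $G=(V,E)$, possibly with parallel edges and loops, with edge weights $w:E\to\{1,2\}$; edges of weight $1$ are red and edges of weight $2$ are blue. An orientation of $E$ replaces each edge by one arc with the same end vertices (parallel edges are distinguished, and a loop at $x$ becomes the arc $(x,x)$). It is feasible if at every vertex the number of entering red arcs plus twice the number of entering blue arcs is at least $2$. A reconfiguration sequence between two feasible orientations is a finite sequence of feasible orientations from the first to the second in which any two consecutive ones are equal or differ by reversing the direction of exactly one edge. The problem C2C asks, given a constraint graph $G$ and two feasible orientations $A_{\mathrm{ini}}$ and $A_{\mathrm{tar}}$ of its edges, whether there is a reconfiguration sequence between them. **Theorem.** There is an algorithm that decides C2C on every instance $(G,A_{\mathrm{ini}},A_{\mathrm{tar}})$, given as an edge list, in $2^{O(k)}\cdot\mathrm{poly}(|V|+|E|)$ steps, where $k$ is the number of blue edges of $G$; on constraint graphs without parallel edges this is $2^{O(k)}\cdot\mathrm{poly}(|V|)$ steps. (Steps are those of a unit-cost random access machine whose arithmetic operations are addition and truncated subtraction.) -/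

import Mathlib

/-! ## Constraint graphs, orientations, reconfiguration -/

namespace NCL

/-- A constraint graph: an undirected graph with vertex set `V` and edge set `E`, parallel edges and
loops being allowed, in which every edge has weight one or two. -/
structure ConstraintGraph (V E : Type*) where
  /-- the unordered pair of end vertices of an edge -/
  ends : E → Sym2 V
  /-- the weight of an edge -/
  weight : E → ℕ
  weight_eq : ∀ e, weight e = 1 ∨ weight e = 2

namespace ConstraintGraph

variable {V E : Type*}

/-- The set of red edges, those of weight one. -/
def redEdges [Fintype E] (G : ConstraintGraph V E) : Finset E :=
  Finset.univ.filter (fun e => G.weight e = 1)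

/-- The set of blue edges, those of weight two. -/
def blueEdges [Fintype E] (G : ConstraintGraph V E) : Finset E :=
  Finset.univ.filter (fun e => G.weight e = 2)

/-- An orientation replaces each edge by one arc `(tail, head)` having the same end vertices.
In particular a loop at `x` can only be replaced by the arc `(x, x)`. -/
@[ext]
structure Orientation (G : ConstraintGraph V E) where
  /-- the arc that replaces an edge -/
  arc : E → V × V
  arc_ends : ∀ e, s((arc e).1, (arc e).2) = G.ends e

namespace Orientation

variable {G : ConstraintGraph V E}

/-- The number of arcs coming from edges in `F` that enter `v`. -/
def indegree [DecidableEq V] (A : G.Orientation) (F : Finset E) (v : V) : ℕ :=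
  (F.filter (fun e => (A.arc e).2 = v)).card

/-- An orientation is feasible if every vertex has in-weight at least two. -/
def Feasible [DecidableEq V] [Fintype E] (A : G.Orientation) : Prop :=
  ∀ v : V, 2 ≤ A.indegree G.redEdges v + 2 * A.indegree G.blueEdges v

/-- The orientation obtained by reversing the direction of one edge. -/
def reverse [DecidableEq E] (A : G.Orientation) (e : E) : G.Orientation where
  arc := Function.update A.arc e (A.arc e).swap
  arc_ends := by
    intro f
    by_cases h : f = e
    · subst h
      rw [Function.update_self, ← A.arc_ends f]
      exact Sym2.eq_swap
    · rw [Function.update_of_ne h]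
      exact A.arc_ends f

/-- Two orientations are adjacent if they are equal or differ by the reversal of one edge. -/
def Adjacent [DecidableEq E] (A B : G.Orientation) : Prop :=
  B = A ∨ ∃ e, B = A.reverse e

/-- There is a reconfiguration sequence between `A` and `B`: a finite sequence of feasible
orientations from `A` to `B` in which consecutive ones are adjacent. -/
def Reconfigurable [DecidableEq V] [Fintype E] [DecidableEq E] (A B : G.Orientation) : Prop :=
  ∃ (l : ℕ) (S : ℕ → G.Orientation), S 0 = A ∧ S l = B ∧
    (∀ i ≤ l, (S i).Feasible) ∧ ∀ i < l, (S i).Adjacent (S (i + 1))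

end Orientation

end ConstraintGraph

/-! ## A random access machine

Programs of a random access machine with structured control flow. The memory consists of arrays of
cells holding natural numbers; a program can mention only finitely many arrays (their names are
constants of the program), and the cells of an array are addressed by computed values. The only
arithmetic operations are addition and truncated subtraction, so that the number of binary digits of
a computed value grows by at most one per step; thus the unit-cost step count below is polynomially
related to the running time of Turing machines. -/

/-- A memory state: `s a i` is the content of cell `i` of array `a`. -/
abbrev State := ℕ → ℕ → ℕ

/-- Expressions: constants, reading cell `i` of array `a`, addition, truncated subtraction. -/
inductive Expr where
  | const (n : ℕ) : Expr
  | read (a : ℕ) (i : Expr) : Expr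
  | plus (x y : Expr) : Expr
  | minus (x y : Expr) : Expr

/-- The value of an expression in a state. -/
def Expr.eval (s : State) : Expr → ℕ
  | .const n => n
  | .read a i => s a (i.eval s)
  | .plus x y => x.eval s + y.eval s
  | .minus x y => x.eval s - y.eval s

/-- The number of steps for evaluating an expression, one for each operation in it. -/
def Expr.cost : Expr → ℕ
  | .const _ => 1
  | .read _ i => i.cost + 1
  | .plus x y => x.cost + y.cost + 1
  | .minus x y => x.cost + y.cost + 1

/-- Programs. `write a i x` stores the value of `x` in the cell of array `a` whose address is the
value of `i`. A condition holds if its value is nonzero. -/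
inductive Program where
  | skip : Program
  | write (a : ℕ) (i x : Expr) : Program
  | seq (P Q : Program) : Program
  | cond (b : Expr) (P Q : Program) : Program
  | loop (b : Expr) (P : Program) : Program

/-- `Runs P s t s'`: started in state `s`, the program `P` halts after exactly `t` steps, in
state `s'`. -/
inductive Runs : Program → State → ℕ → State → Prop where
  | skip (s : State) : Runs .skip s 1 s
  | write (a : ℕ) (i x : Expr) (s : State) :
      Runs (.write a i x) s (i.cost + x.cost + 1)
        (Function.update s a (Function.update (s a) (i.eval s) (x.eval s)))
  | seq {P Q : Program} {s s₁ s₂ : State} {t₁ t₂ : ℕ}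
      (hP : Runs P s t₁ s₁) (hQ : Runs Q s₁ t₂ s₂) : Runs (.seq P Q) s (t₁ + t₂) s₂
  | cond_true {b : Expr} {P Q : Program} {s s' : State} {t : ℕ}
      (hb : b.eval s ≠ 0) (hP : Runs P s t s') : Runs (.cond b P Q) s (b.cost + 1 + t) s'
  | cond_false {b : Expr} {P Q : Program} {s s' : State} {t : ℕ}
      (hb : b.eval s = 0) (hQ : Runs Q s t s') : Runs (.cond b P Q) s (b.cost + 1 + t) s'
  | loop_true {b : Expr} {P : Program} {s s₁ s₂ : State} {t₁ t₂ : ℕ}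
      (hb : b.eval s ≠ 0) (hP : Runs P s t₁ s₁) (hL : Runs (.loop b P) s₁ t₂ s₂) :
      Runs (.loop b P) s (b.cost + 1 + t₁ + t₂) s₂
  | loop_false {b : Expr} {P : Program} {s : State}
      (hb : b.eval s = 0) : Runs (.loop b P) s (b.cost + 1) s

/-- A program has at most one run from a given state, so that its step count and its final state
are well defined. -/
theorem Runs.unique {P : Program} {s s₁ s₂ : State} {t₁ t₂ : ℕ}
    (h₁ : Runs P s t₁ s₁) (h₂ : Runs P s t₂ s₂) : t₁ = t₂ ∧ s₁ = s₂ := by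
  induction h₁ generalizing t₂ s₂ with
  | skip s => cases h₂; exact ⟨rfl, rfl⟩
  | write a i x s => cases h₂; exact ⟨rfl, rfl⟩
  | seq _ _ ihP ihQ =>
    cases h₂ with
    | seq hP' hQ' =>
      obtain ⟨rfl, rfl⟩ := ihP hP'
      obtain ⟨rfl, rfl⟩ := ihQ hQ'
      exact ⟨rfl, rfl⟩
  | cond_true hb _ ihP =>
    cases h₂ with
    | cond_true _ hP' =>
      obtain ⟨rfl, rfl⟩ := ihP hP'
      exact ⟨rfl, rfl⟩
    | cond_false hb' _ => exact absurd hb' hb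
  | cond_false hb _ ihQ =>
    cases h₂ with
    | cond_true hb' _ => exact absurd hb hb'
    | cond_false _ hQ' =>
      obtain ⟨rfl, rfl⟩ := ihQ hQ'
      exact ⟨rfl, rfl⟩
  | loop_true hb _ _ ihP ihL =>
    cases h₂ with
    | loop_true _ hP' hL' =>
      obtain ⟨rfl, rfl⟩ := ihP hP'
      obtain ⟨rfl, rfl⟩ := ihL hL'
      exact ⟨rfl, rfl⟩
    | loop_false hb' => exact absurd hb' hb
  | loop_false hb =>
    cases h₂ with
    | loop_true hb' _ _ => exact absurd hb hb'
    | loop_false _ => exact ⟨rfl, rfl⟩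

/-! ## Input and output -/

/-- The array with entries `f 0, …, f (m - 1)`, followed by zeros. -/
def table {m : ℕ} (f : Fin m → ℕ) : ℕ → ℕ :=
  fun i => if h : i < m then f ⟨i, h⟩ else 0

/-- The initial memory for the instance `(G, A, B)`, as an edge list. Array `0` holds the number of
vertices and the number of edges, array `1` the weights of the edges, arrays `2` and `3` the tails
and heads of the arcs of `A`, arrays `4` and `5` those of the arcs of `B`; everything else is zero.
The end vertices of an edge are those of its arc in `A`. -/
def input {n m : ℕ} (G : ConstraintGraph (Fin n) (Fin m)) (A B : G.Orientation) : State
  | 0 => fun i => if i = 0 then n else if i = 1 then m else 0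
  | 1 => table G.weight
  | 2 => table (fun e => ((A.arc e).1 : ℕ))
  | 3 => table (fun e => ((A.arc e).2 : ℕ))
  | 4 => table (fun e => ((B.arc e).1 : ℕ))
  | 5 => table (fun e => ((B.arc e).2 : ℕ))
  | _ => fun _ => 0

/-- The output of a halted program: the content of the first cell of array `0`. -/
def output (s : State) : ℕ := s 0 0

end NCL

namespace NCL

/-! Take the initial orientation as reference and describe any other by the set of reversed edges.
An edge that is not a loop can be reversed feasibly exactly if the load of its head is at least two
plus its weight, and such a reversal can be undone.

Up to edges that never move, only the blue part of an orientation matters. Let `x` be reachable, and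
let `y` be feasible, agree with `x` on the blue edges, and agree with the initial orientation on
every edge that no reachable orientation reverses. Then `y` is reachable (`reach_of_agree`). Indeed,
the edges in which `x` and `y` differ are red. If each of them has a predecessor among them, they
contain a directed cycle of `x`, and a red cycle can be reversed as soon as one of its edges can
ever be reversed (`reach_reverse_cycle`). Otherwise one of them enters, in `y`, a vertex that no
differing edge enters in `x`; that vertex then has surplus in `y`, and the edge can be reversed
there. Either way the difference shrinks.

So one representative for each blue part suffices, at most `2 ^ k` in all. To reverse an edge from a
representative, surplus is moved to its head by reversing red paths that lead from the head to
vertices with surplus. If this gets stuck, the set `Z` of vertices reached by red paths is a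
certificate (`Blocked`): no orientation with the same blue part sends more weight into `Z`, and
counting this weight shows that no feasible orientation with this blue part can spare the edge
(`Blocked.not_surplus`).

A list of representatives closed under the reversals that are not so excluded, with the set of edges
reversed on the way, therefore decides reachability (`reach_iff_of_saturated`). The program
generates this list. Every entry tries every edge, and every try searches the list once, which gives
the factor `2 ^ k * 2 ^ k` times a polynomial. -/

/-- A constraint graph with a reference orientation: the arc of `e` runs from `tl e` to `hd e`.
Its orientations are encoded by `x : E → Bool`, where `x e = true` if `e` is reversed. -/
structure Network (V E : Type*) where
  /-- the head of an edge in the reference orientation -/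
  hd : E → V
  /-- the tail of an edge in the reference orientation -/
  tl : E → V
  /-- the weight of an edge -/
  wt : E → ℕ
  wt_eq : ∀ e, wt e = 1 ∨ wt e = 2

namespace Network

variable {V E : Type*} (N : Network V E)

/-- The head of `e` in the orientation `x`. -/
def head (x : E → Bool) (e : E) : V := if x e then N.tl e else N.hd e

/-- The tail of `e` in the orientation `x`. -/
def tail (x : E → Bool) (e : E) : V := if x e then N.hd e else N.tl e

/-- Two orientations agree on the blue edges. -/
def SameBlue (x y : E → Bool) : Prop := ∀ e, N.wt e = 2 → x e = y e

variable {N} in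
theorem SameBlue.symm {x y : E → Bool} (h : N.SameBlue x y) : N.SameBlue y x :=
  fun e he => (h e he).symm

variable {N} in
theorem SameBlue.trans {x y z : E → Bool} (h : N.SameBlue x y) (h' : N.SameBlue y z) :
    N.SameBlue x z :=
  fun e he => (h e he).trans (h' e he)

theorem SameBlue.refl (x : E → Bool) : N.SameBlue x x := fun _ _ => rfl

theorem head_congr {x y : E → Bool} {e : E} (h : x e = y e) : N.head x e = N.head y e := by
  simp [head, h]

theorem tail_congr {x y : E → Bool} {e : E} (h : x e = y e) : N.tail x e = N.tail y e := by
  simp [tail, h]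

theorem head_of_ne {x y : E → Bool} {e : E} (h : x e ≠ y e) : N.head x e = N.tail y e := by
  have : x e = !y e := by cases hx : x e <;> cases hy : y e <;> simp_all
  cases hy : y e <;> simp [head, tail, this, hy]

/-- The orientation obtained by reversing the edges in `S`. -/
def reverse [DecidableEq E] (S : Finset E) (x : E → Bool) : E → Bool :=
  fun e => if e ∈ S then !x e else x e

theorem reverse_apply [DecidableEq E] (S : Finset E) (x : E → Bool) (e : E) :
    reverse S x e = if e ∈ S then !x e else x e := rfl

theorem reverse_reverse [DecidableEq E] (S : Finset E) (x : E → Bool) :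
    reverse S (reverse S x) = x := by
  funext e
  by_cases h : e ∈ S <;> simp [reverse, h]

theorem reverse_comm [DecidableEq E] (S T : Finset E) (x : E → Bool) :
    reverse S (reverse T x) = reverse T (reverse S x) := by
  funext e
  by_cases h : e ∈ S <;> by_cases h' : e ∈ T <;> simp [reverse, h, h']

theorem reverse_of_notMem [DecidableEq E] {S : Finset E} {x : E → Bool} {e : E} (h : e ∉ S) :
    reverse S x e = x e := by simp [reverse, h]

theorem reverse_of_mem [DecidableEq E] {S : Finset E} {x : E → Bool} {e : E} (h : e ∈ S) :
    reverse S x e = !x e := by simp [reverse, h]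

theorem sameBlue_reverse_red [DecidableEq E] {e : E} (he : N.wt e = 1) (x : E → Bool) :
    N.SameBlue (reverse {e} x) x := by
  intro f hf
  refine reverse_of_notMem ?_
  rintro h
  rw [Finset.mem_singleton] at h
  subst h
  omega

theorem mem_toFinset_cycle [DecidableEq E] {c : Cycle E} {e : E} : e ∈ c.toFinset ↔ e ∈ c := by
  induction c using Cycle.induction_on with
  | nil => simp
  | cons f l _ => rw [Cycle.coe_toFinset, List.mem_toFinset, Cycle.mem_coe_iff]

-- Consecutive arcs share a vertex, so tails and heads match after a shift by one. With `g = e` the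
-- list closes up to a cycle, and its tails are a permutation of its heads.
variable {N} in
theorem map_tail_eq_of_isChain {x₀ : E → Bool} (g : E) (l : List E) : ∀ e,
    (e :: (l ++ [g])).IsChain (fun e f => N.tail x₀ e = N.head x₀ f) →
      (e :: l).map (N.tail x₀) = (l ++ [g]).map (N.head x₀) := by
  induction l with
  | nil =>
    intro e h
    simpa using h
  | cons f l ih =>
    intro e h
    simp only [List.cons_append, List.isChain_cons_cons] at h
    have := ih f h.2
    simp only [List.map_cons, List.cons_append] at this ⊢
    rw [h.1, this]

/-! ### Loads and reversals of single edges -/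

variable [DecidableEq V] [Fintype E] [DecidableEq E]

/-- The total weight of the arcs that enter `v`. -/
def load (x : E → Bool) (v : V) : ℕ := ∑ e, if N.head x e = v then N.wt e else 0

/-- Each arc of `S` moves its weight from its head to its tail. The additive form avoids truncated
subtraction and covers loops, which contribute equally to both sides. -/
theorem load_reverse (S : Finset E) (x : E → Bool) (v : V) :
    N.load (reverse S x) v + (∑ e ∈ S, if N.head x e = v then N.wt e else 0) =
      N.load x v + ∑ e ∈ S, if N.tail x e = v then N.wt e else 0 := by
  unfold load
  rw [← Finset.sum_add_sum_compl S (fun e => if N.head (reverse S x) e = v then N.wt e else 0),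
    ← Finset.sum_add_sum_compl S (fun e => if N.head x e = v then N.wt e else 0)]
  have h₁ : ∀ e ∈ S, (if N.head (reverse S x) e = v then N.wt e else 0) =
      if N.tail x e = v then N.wt e else 0 := by
    intro e he
    rw [N.head_of_ne (y := x)]
    simp [reverse_of_mem he]
  have h₂ : ∀ e ∈ Sᶜ, (if N.head (reverse S x) e = v then N.wt e else 0) =
      if N.head x e = v then N.wt e else 0 := by
    intro e he
    rw [N.head_congr (reverse_of_notMem (by simpa using he))]
  rw [Finset.sum_congr rfl h₁, Finset.sum_congr rfl h₂]
  omega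

theorem load_reverse_singleton (e : E) (x : E → Bool) (v : V) :
    N.load (reverse {e} x) v + (if N.head x e = v then N.wt e else 0) =
      N.load x v + if N.tail x e = v then N.wt e else 0 := by
  simpa using N.load_reverse {e} x v

/-- Every vertex is entered by arcs of total weight at least two. -/
def Feasible (x : E → Bool) : Prop := ∀ v, 2 ≤ N.load x v

/-- The orientation `y` arises from `x` by reversing one edge whose head does not need it. -/
def Step (x y : E → Bool) : Prop :=
  ∃ e, 2 + N.wt e ≤ N.load x (N.head x e) ∧ y = reverse {e} x

/-- Reachability by feasible reversals of single edges. -/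
abbrev Reach : (E → Bool) → (E → Bool) → Prop := Relation.ReflTransGen N.Step

variable {N}

theorem Step.feasible {x y : E → Bool} (h : N.Step x y) (hx : N.Feasible x) : N.Feasible y := by
  obtain ⟨e, he, rfl⟩ := h
  intro v
  have h₁ := N.load_reverse_singleton e x v
  have h₂ := hx v
  by_cases hv : N.head x e = v
  · subst hv
    simp only [if_true] at h₁
    omega
  · simp only [hv, if_false] at h₁
    omega

/-- The tail had load at least two and gains the weight of `e`; for a loop nothing changes. Thus
surplus travels backwards along the reversed arc, which makes steps invertible and lets them be
chained along trails. -/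
theorem load_tail_of_surplus {x : E → Bool} (hx : N.Feasible x) {e : E}
    (he : 2 + N.wt e ≤ N.load x (N.head x e)) :
    2 + N.wt e ≤ N.load (reverse {e} x) (N.tail x e) := by
  have h₁ := N.load_reverse_singleton e x (N.tail x e)
  have h₂ := hx (N.tail x e)
  by_cases hv : N.head x e = N.tail x e
  · rw [hv] at he
    simp only [hv, if_true] at h₁
    omega
  · simp only [hv, if_false, if_true] at h₁
    omega

theorem Step.symm {x y : E → Bool} (h : N.Step x y) (hx : N.Feasible x) : N.Step y x := by
  obtain ⟨e, he, rfl⟩ := h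
  refine ⟨e, ?_, (reverse_reverse _ _).symm⟩
  have := load_tail_of_surplus hx he
  rwa [N.head_of_ne (x := reverse {e} x) (y := x) (by simp [reverse])]

theorem Reach.feasible {x y : E → Bool} (h : N.Reach x y) (hx : N.Feasible x) :
    N.Feasible y := by
  induction h with
  | refl => exact hx
  | tail _ h ih => exact h.feasible ih

theorem Reach.symm {x y : E → Bool} (h : N.Reach x y) (hx : N.Feasible x) : N.Reach y x := by
  induction h with
  | refl => exact .refl
  | tail h₁ h₂ ih => exact .head (h₂.symm (Reach.feasible h₁ hx)) ih

/-! ### Reversing trails and cycles of red arcs -/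

/-- If the head of the last arc of a red trail has surplus, then the arcs of the trail can be
reversed one by one, from the last to the first. -/
theorem reach_reverse_trail {x₀ : E → Bool} (l : List E) :
    ∀ x : E → Bool, N.Feasible x → l.Nodup → (∀ e ∈ l, N.wt e = 1) → (∀ e ∈ l, x e = x₀ e) →
      l.IsChain (fun e f => N.tail x₀ e = N.head x₀ f) →
      (∀ e ∈ l.head?, 3 ≤ N.load x (N.head x₀ e)) → N.Reach x (reverse l.toFinset x) := by
  induction l with
  | nil =>
    intro x _ _ _ _ _ _
    have : reverse ([] : List E).toFinset x = x := by funext e; simp [reverse]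
    rw [this]
  | cons e l ih =>
    intro x hx hnd hred hx₀ hch hs
    have he : N.wt e = 1 := hred e (by simp)
    have hxe : x e = x₀ e := hx₀ e (by simp)
    have hsur : 2 + N.wt e ≤ N.load x (N.head x e) := by
      rw [he, N.head_congr hxe]
      exact hs e (by simp)
    have hstep : N.Step x (reverse {e} x) := ⟨e, hsur, rfl⟩
    rw [List.nodup_cons] at hnd
    have hrec := ih (reverse {e} x) (hstep.feasible hx) hnd.2 (fun f hf => hred f (by simp [hf]))
      (fun f hf => by
        rw [reverse_of_notMem, hx₀ f (by simp [hf])]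
        rw [Finset.mem_singleton]
        rintro rfl
        exact hnd.1 hf)
      hch.tail
      (fun f hf => by
        -- The list runs against the arcs: the tail of `e`, which has just gained surplus, is the
        -- head of the next arc.
        have := hch.rel_head? hf
        rw [← this, ← N.tail_congr hxe]
        have := load_tail_of_surplus hx hsur
        omega)
    have heq : reverse l.toFinset (reverse {e} x) = reverse (e :: l).toFinset x := by
      funext f
      by_cases h : f = e
      · subst h
        simp [reverse, hnd.1]
      · simp [reverse, h]
    rw [heq] at hrec
    exact .head hstep hrec

/-- Reversing a directed cycle of red arcs does not change the loads. -/
theorem load_reverse_cycle {x₀ x : E → Bool} {c : Cycle E} (hnd : c.Nodup)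
    (hred : ∀ e ∈ c, N.wt e = 1) (hx : ∀ e ∈ c, x e = x₀ e)
    (hch : c.Chain (fun e f => N.tail x₀ e = N.head x₀ f)) (v : V) :
    N.load (reverse c.toFinset x) v = N.load x v := by
  have hrev := N.load_reverse c.toFinset x v
  suffices h : (∑ e ∈ c.toFinset, if N.head x e = v then N.wt e else 0) =
      ∑ e ∈ c.toFinset, if N.tail x e = v then N.wt e else 0 by omega
  induction c using Cycle.induction_on with
  | nil => simp
  | cons e l _ =>
    rw [Cycle.chain_coe_cons] at hch
    rw [Cycle.nodup_coe_iff] at hnd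
    simp only [Cycle.mem_coe_iff] at hred hx
    simp only [Cycle.coe_toFinset]
    have hmap := map_tail_eq_of_isChain e l e hch
    have hperm : ((e :: l).map (N.tail x₀)).Perm ((e :: l).map (N.head x₀)) := by
      rw [hmap, List.map_append, List.map_cons]
      exact List.perm_append_comm
    have h₁ : ∀ f ∈ (e :: l).toFinset, (if N.head x f = v then N.wt f else 0) =
        if N.head x₀ f = v then 1 else 0 := by
      intro f hf
      rw [List.mem_toFinset] at hf
      rw [N.head_congr (hx f hf), hred f hf]
    have h₂ : ∀ f ∈ (e :: l).toFinset, (if N.tail x f = v then N.wt f else 0) =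
        if N.tail x₀ f = v then 1 else 0 := by
      intro f hf
      rw [List.mem_toFinset] at hf
      rw [N.tail_congr (hx f hf), hred f hf]
    rw [Finset.sum_congr rfl h₁, Finset.sum_congr rfl h₂, List.sum_toFinset _ hnd,
      List.sum_toFinset _ hnd]
    have := (hperm.map (fun u => if u = v then 1 else 0)).sum_eq
    rw [List.map_map, List.map_map] at this
    exact this.symm

/-- A directed cycle of red arcs can be reversed if some arc of it is reversed in some orientation
that can be reached. -/
theorem reach_reverse_cycle {x₀ z : E → Bool} {c : Cycle E} (hnd : c.Nodup)
    (hred : ∀ e ∈ c, N.wt e = 1) (hch : c.Chain (fun e f => N.tail x₀ e = N.head x₀ f))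
    (hz : ∃ e ∈ c, z e ≠ x₀ e) {x : E → Bool} (hxz : N.Reach x z) (hx : N.Feasible x)
    (hx₀ : ∀ e ∈ c, x e = x₀ e) : N.Reach x (reverse c.toFinset x) := by
  induction hxz using Relation.ReflTransGen.head_induction_on with
  | refl =>
    obtain ⟨e, he, hne⟩ := hz
    exact absurd (hx₀ e he) hne
  | @head x x₁ hstep _ ih =>
    have hx₁ := hstep.feasible hx
    obtain ⟨e, he, rfl⟩ := hstep
    by_cases hec : e ∈ c
    -- The first step of the sequence reverses an edge `e` of the cycle, so its head has surplus.
    -- Cut the cycle open at `e` and reverse it as a trail.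
    · obtain ⟨l, rfl⟩ : ∃ l : List E, c = ((e :: l : List E) : Cycle E) := by
        induction c using Cycle.induction_on with
        | nil => exact absurd hec (Cycle.notMem_nil e)
        | cons f l _ =>
          rw [Cycle.mem_coe_iff] at hec
          obtain ⟨s, t, hst⟩ := List.append_of_mem hec
          refine ⟨t ++ s, ?_⟩
          rw [hst, Cycle.coe_eq_coe]
          exact List.isRotated_append
      rw [Cycle.chain_coe_cons] at hch
      rw [Cycle.nodup_coe_iff] at hnd
      simp only [Cycle.mem_coe_iff] at hred hx₀
      rw [Cycle.coe_toFinset]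
      refine reach_reverse_trail (x₀ := x₀) _ x hx hnd hred hx₀ ?_ ?_
      · rw [← List.cons_append] at hch
        exact hch.left_of_append
      · intro f hf
        obtain rfl : e = f := by simpa using hf
        rw [← N.head_congr (hx₀ e (by simp))]
        rw [hred e (by simp)] at he
        omega
    -- Off the cycle, the step at `e` commutes with the reversal of the cycle, which preserves all
    -- loads: reverse `e`, then the cycle, then `e` back.
    · have hrec := ih hx₁ (fun f hf => by
        rw [reverse_of_notMem, hx₀ f hf]
        rw [Finset.mem_singleton]
        rintro rfl
        exact hec hf)
      have hef : e ∉ c.toFinset := by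
        rwa [mem_toFinset_cycle]
      have hstep : N.Step x (reverse {e} x) := ⟨e, he, rfl⟩
      have hload := load_reverse_cycle hnd hred hx₀ hch
      have hstep' : N.Step (reverse c.toFinset x) (reverse c.toFinset (reverse {e} x)) := by
        refine ⟨e, ?_, reverse_comm _ _ _⟩
        rwa [hload, N.head_congr (reverse_of_notMem hef)]
      have hfeas : N.Feasible (reverse c.toFinset x) := by
        intro v
        rw [hload]
        exact hx v
      exact .head hstep (hrec.tail (hstep'.symm hfeas))

omit [DecidableEq V] in
/-- If every edge of a nonempty set `D` of red edges has a predecessor in `D`, then `D` contains a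
directed cycle. -/
theorem exists_cycle {x : E → Bool} {D : Finset E} (hne : D.Nonempty)
    (hpred : ∀ e ∈ D, ∃ f ∈ D, N.tail x e = N.head x f) :
    ∃ c : Cycle E, c.Nodup ∧ c.toFinset.Nonempty ∧ c.toFinset ⊆ D ∧
      c.Chain (fun e f => N.tail x e = N.head x f) := by
  choose! p hp using hpred
  obtain ⟨e₀, he₀⟩ := hne
  have hmem : ∀ i, p^[i] e₀ ∈ D := by
    intro i
    induction i with
    | zero => exact he₀
    | succ i ih =>
      rw [Function.iterate_succ_apply']
      exact (hp _ ih).1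
  -- Iterating the predecessor map must repeat an edge; the periodic orbit found in this way is the
  -- cycle.
  obtain ⟨i, j, hij, heq⟩ := Finite.exists_ne_map_eq_of_infinite (fun i : ℕ => p^[i] e₀)
  wlog hlt : i < j generalizing i j
  · exact this j i hij.symm heq.symm (by omega)
  have hper : p^[i] e₀ ∈ Function.periodicPts p := by
    refine ⟨j - i, by omega, ?_⟩
    change p^[j - i] (p^[i] e₀) = p^[i] e₀
    rw [← Function.iterate_add_apply, Nat.sub_add_cancel hlt.le]
    exact heq.symm
  refine ⟨Function.periodicOrbit p (p^[i] e₀), Function.nodup_periodicOrbit, ⟨p^[i] e₀, ?_⟩, ?_, ?_⟩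
  · rw [mem_toFinset_cycle]
    exact Function.self_mem_periodicOrbit hper
  · intro e he
    rw [mem_toFinset_cycle, Function.mem_periodicOrbit_iff hper] at he
    obtain ⟨k, rfl⟩ := he
    rw [← Function.iterate_add_apply]
    exact hmem _
  · rw [Function.periodicOrbit_chain]
    intro k _
    rw [← Function.iterate_add_apply, ← Function.iterate_add_apply]
    have := (hp _ (hmem (k + i))).2
    rw [← Function.iterate_succ_apply' p] at this
    rwa [show k + 1 + i = (k + i).succ by omega]

/-! ### Reachability between orientations with the same blue part -/

/-- A feasible orientation that agrees on the blue edges with one that can be reached from `x₀`, and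
agrees with `x₀` on the edges that can never be reversed, can be reached from `x₀`. -/
theorem reach_of_agree {x₀ : E → Bool} (h₀ : N.Feasible x₀) (k : ℕ) : ∀ x y : E → Bool,
    (Finset.univ.filter (fun e => x e ≠ y e)).card = k → N.Feasible y → N.Reach x₀ x →
      N.SameBlue x y → (∀ e, y e ≠ x₀ e → ∃ z, N.Reach x₀ z ∧ z e ≠ x₀ e) → N.Reach x₀ y := by
  induction k using Nat.strong_induction_on with
  | _ k ih =>
  intro x y hk hy hx hxy hrig
  have hxf := hx.feasible h₀
  set D := Finset.univ.filter (fun e => x e ≠ y e) with hD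
  have hmemD : ∀ e, e ∈ D ↔ x e ≠ y e := by simp [hD]
  have hred : ∀ e ∈ D, N.wt e = 1 := by
    intro e he
    rcases N.wt_eq e with h | h
    · exact h
    · exact absurd (hxy e h) ((hmemD e).1 he)
  -- Since `x` and `y` differ on `e`, no value of `e` is forced: one of `x`, `x₀` and the
  -- orientation supplied by `hrig` avoids `u`.
  have hnotrig : ∀ e ∈ D, ∀ u : Bool, ∃ z, N.Reach x₀ z ∧ z e ≠ u := by
    intro e he u
    by_cases hxu : x e = u
    · by_cases hyx : y e = x₀ e
      · refine ⟨x₀, .refl, ?_⟩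
        rw [← hyx, ← hxu]
        exact ((hmemD e).1 he).symm
      · obtain ⟨z, hz, hne⟩ := hrig e hyx
        by_cases hu : x₀ e = u
        · exact ⟨z, hz, by rwa [← hu]⟩
        · exact ⟨x₀, .refl, hu⟩
    · exact ⟨x, hx, hxu⟩
  have hless : ∀ (x' y' : E → Bool) (S : Finset E), S.Nonempty → S ⊆ D →
      (∀ e, x' e ≠ y' e → e ∈ D ∧ e ∉ S) →
      (Finset.univ.filter (fun e => x' e ≠ y' e)).card < k := by
    intro x' y' S ⟨f, hf⟩ hSD h
    rw [← hk]
    refine Finset.card_lt_card (Finset.ssubset_iff_subset_ne.2 ⟨?_, ?_⟩)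
    · intro e he
      exact (h e (by simpa using he)).1
    · intro heq
      have : f ∈ Finset.univ.filter (fun e => x' e ≠ y' e) := heq ▸ hSD hf
      exact (h f (by simpa using this)).2 hf
  rcases D.eq_empty_or_nonempty with hem | hne
  · have : x = y := by
      funext e
      by_contra h
      have := (hmemD e).2 h
      simp [hem] at this
    exact this ▸ hx
  by_cases hpred : ∀ e ∈ D, ∃ f ∈ D, N.tail x e = N.head x f
  -- Reversing a cycle inside `D` moves `x` closer to `y`. Some edge of it takes another value in a
  -- reachable orientation, and `x` is connected to that one through `x₀`.
  · obtain ⟨c, hnd, hcne, hcD, hch⟩ := exists_cycle hne hpred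
    have hcred : ∀ e ∈ c, N.wt e = 1 := fun e he => hred e (hcD (mem_toFinset_cycle.2 he))
    obtain ⟨e, he⟩ := hcne
    obtain ⟨z, hz, hze⟩ := hnotrig e (hcD he) (x e)
    have hx' := reach_reverse_cycle hnd hcred hch ⟨e, mem_toFinset_cycle.1 he, hze⟩
      ((hx.symm h₀).trans hz) hxf (fun _ _ => rfl)
    have hdiff : ∀ f, reverse c.toFinset x f ≠ y f → f ∈ D ∧ f ∉ c.toFinset := by
      intro f hf
      by_cases hfc : f ∈ c.toFinset
      · exfalso
        rw [reverse_of_mem hfc] at hf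
        have := (hmemD f).1 (hcD hfc)
        cases h : x f <;> cases h' : y f <;> simp_all
      · rw [reverse_of_notMem hfc] at hf
        exact ⟨(hmemD f).2 hf, hfc⟩
    refine ih _ (hless _ _ _ ⟨e, he⟩ hcD hdiff) _ y rfl hy (hx.trans hx') ?_ hrig
    intro f hf
    by_contra h
    have := hred f (hdiff f h).1
    omega
  · push Not at hpred
    obtain ⟨e, he, hpred⟩ := hpred
    -- No differing edge enters the tail of `e` in `x`. So all arcs entering this vertex in `x`
    -- still enter it in `y`, and `e` enters it in addition.
    have hsur : 2 + N.wt e ≤ N.load y (N.head y e) := by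
      rw [N.head_of_ne ((hmemD e).1 he).symm]
      refine le_trans (Nat.add_le_add_right (hxf (N.tail x e)) _) ?_
      unfold load
      rw [← Finset.add_sum_erase Finset.univ _ (Finset.mem_univ e),
        ← Finset.add_sum_erase Finset.univ _ (Finset.mem_univ e),
        if_neg (fun h => hpred e he h.symm), if_pos (N.head_of_ne ((hmemD e).1 he).symm), zero_add,
        add_comm]
      refine Nat.add_le_add_left (Finset.sum_le_sum fun f _ => ?_) _
      by_cases hf : f ∈ D
      · rw [if_neg (fun h => hpred f hf h.symm)]
        exact Nat.zero_le _
      · rw [hmemD, not_not] at hf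
        rw [N.head_congr hf]
    have hstep : N.Step y (reverse {e} y) := ⟨e, hsur, rfl⟩
    have hdiff : ∀ f, x f ≠ reverse {e} y f → f ∈ D ∧ f ∉ ({e} : Finset E) := by
      intro f hf
      by_cases hfe : f = e
      · subst hfe
        exfalso
        rw [reverse_of_mem (Finset.mem_singleton_self f)] at hf
        have := (hmemD f).1 he
        cases h : x f <;> cases h' : y f <;> simp_all
      · rw [reverse_of_notMem (by simpa using hfe)] at hf
        exact ⟨(hmemD f).2 hf, by simpa using hfe⟩
    -- This time `y` moves closer to `x`: the induction reaches `y` with `e` reversed, and the last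
    -- step is undone.
    refine Relation.ReflTransGen.tail (ih _ (hless _ _ _ ⟨e, Finset.mem_singleton_self e⟩
      (by simpa using he) hdiff) x _ rfl (hstep.feasible hy) hx ?_ ?_) (hstep.symm hy)
    · intro f hf
      by_contra h
      have := hred f (hdiff f h).1
      omega
    · intro f hf
      by_cases hfe : f = e
      · subst hfe
        exact hnotrig f he _
      · rw [reverse_of_notMem (by simpa using hfe)] at hf
        exact hrig f hf

/-! ### Certificates -/

/-- No red path leads from `v` to a vertex with surplus, and the load of `v` is less than `2 + q`. -/
def Blocked (N : Network V E) (x : E → Bool) (v : V) (q : ℕ) : Prop :=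
  ∃ Z : Finset V, v ∈ Z ∧ (∀ e, N.wt e = 1 → N.tail x e ∈ Z → N.head x e ∈ Z) ∧
    (∀ u ∈ Z, u ≠ v → N.load x u ≤ 2) ∧ N.load x v < 2 + q

omit [DecidableEq E] in
theorem sum_load (x : E → Bool) (Z : Finset V) :
    ∑ v ∈ Z, N.load x v = ∑ e, if N.head x e ∈ Z then N.wt e else 0 := by
  unfold load
  rw [Finset.sum_comm]
  refine Finset.sum_congr rfl fun e _ => ?_
  rw [Finset.sum_ite_eq]

-- An edge directed differently in `x` and `z` is red, and its head in `z` is its tail in `x`. As no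
-- red arc of `x` leaves `Z`, an edge that enters `Z` in `z` also does so in `x`.
omit [Fintype E] [DecidableEq E] in
theorem ite_head_le {x z : E → Bool} (hxz : N.SameBlue x z) {Z : Finset V}
    (hZ : ∀ e, N.wt e = 1 → N.tail x e ∈ Z → N.head x e ∈ Z) (e : E) :
    (if N.head z e ∈ Z then N.wt e else 0) ≤ if N.head x e ∈ Z then N.wt e else 0 := by
  by_cases hz : N.head z e ∈ Z
  · suffices N.head x e ∈ Z by simp [this, hz]
    by_cases hxe : x e = z e
    · rwa [N.head_congr hxe]
    · refine hZ e ?_ ?_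
      · rcases N.wt_eq e with h | h
        · exact h
        · exact absurd (hxz e h) hxe
      · rwa [← N.head_of_ne (fun h => hxe h.symm)]
  · simp [hz]

-- Compare the total loads on `Z`: by `ite_head_le` that of `z` is at most that of `x`. Suppose `z`
-- can spare `e`. If `e` has the same direction in both, the loads of `z` on `Z` are at least those
-- of `x`, and larger at the head of `e`, a contradiction. Otherwise `e` is red, so `x` has load at
-- most two everywhere on `Z` and `z` has at least as much. If the head of `e` in `z` lies in `Z`,
-- its surplus makes the total of `z` larger; if not, `e` enters `Z` only in `x`, and the total of
-- `z` is smaller.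
omit [DecidableEq E] in
theorem Blocked.not_surplus {x z : E → Bool} {e : E} (h : N.Blocked x (N.head x e) (N.wt e))
    (hxz : N.SameBlue x z) (hz : N.Feasible z) : N.load z (N.head z e) < 2 + N.wt e := by
  by_contra! hsur
  obtain ⟨Z, hv, hZ, hle, hlt⟩ := h
  have hsum : ∑ v ∈ Z, N.load z v ≤ ∑ v ∈ Z, N.load x v := by
    rw [sum_load, sum_load]
    exact Finset.sum_le_sum fun f _ => ite_head_le hxz hZ f
  have hrest : ∑ u ∈ Z.erase (N.head x e), N.load x u ≤
      ∑ u ∈ Z.erase (N.head x e), N.load z u := by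
    refine Finset.sum_le_sum fun u hu => ?_
    rw [Finset.mem_erase] at hu
    exact (hle u hu.2 hu.1).trans (hz u)
  have hx := Finset.add_sum_erase Z (N.load x) hv
  have hz' := Finset.add_sum_erase Z (N.load z) hv
  by_cases hxe : x e = z e
  · rw [← N.head_congr hxe] at hsur
    omega
  · have hred : N.wt e = 1 := by
      rcases N.wt_eq e with h | h
      · exact h
      · exact absurd (hxz e h) hxe
    have hall : ∀ u ∈ Z, N.load x u ≤ N.load z u := by
      intro u hu
      by_cases huv : u = N.head x e
      · have := hz u
        rw [huv] at this ⊢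
        omega
      · exact (hle u hu huv).trans (hz u)
    by_cases hmem : N.head z e ∈ Z
    · have : ∑ v ∈ Z, N.load x v < ∑ v ∈ Z, N.load z v := by
        refine Finset.sum_lt_sum hall ⟨_, hmem, ?_⟩
        by_cases huv : N.head z e = N.head x e
        · rw [← huv] at hlt
          omega
        · have := hle _ hmem huv
          omega
      omega
    · have : ∑ v ∈ Z, N.load z v < ∑ v ∈ Z, N.load x v := by
        rw [sum_load, sum_load]
        refine Finset.sum_lt_sum (fun f _ => ite_head_le hxz hZ f) ⟨e, Finset.mem_univ e, ?_⟩
        rw [if_neg hmem, if_pos hv]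
        omega
      have := Finset.sum_le_sum hall
      omega

/-! ### Saturated lists decide reachability -/

/-- Reachability is decided by a set `L` of reachable orientations and a set `F` of edges which are
closed under the reversals that are not excluded by a certificate. -/
theorem reach_iff_of_saturated {x₀ : E → Bool} (h₀ : N.Feasible x₀) {L : Set (E → Bool)}
    {F : E → Prop} (hx₀ : x₀ ∈ L) (hL : ∀ x ∈ L, N.Reach x₀ x)
    (hF : ∀ e, F e → ∃ z, N.Reach x₀ z ∧ z e ≠ x₀ e)
    (hsat : ∀ x ∈ L, ∀ e, (F e ∧ ∃ z ∈ L, N.SameBlue z (reverse {e} x)) ∨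
      ∃ x', N.SameBlue x' x ∧ N.Blocked x' (N.head x' e) (N.wt e))
    {y : E → Bool} (hy : N.Feasible y) :
    N.Reach x₀ y ↔ (∃ x ∈ L, N.SameBlue x y) ∧ ∀ e, y e ≠ x₀ e → F e := by
  constructor
  · intro h
    clear hy
    induction h with
    | refl => exact ⟨⟨x₀, hx₀, SameBlue.refl N x₀⟩, fun e he => absurd rfl he⟩
    | @tail z y hz hstep ih =>
      have hzf := Reach.feasible hz h₀
      obtain ⟨⟨x, hx, hxz⟩, hFz⟩ := ih
      obtain ⟨e, he, rfl⟩ := hstep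
      -- The second alternative cannot occur: its certificate depends only on the blue part, which
      -- `z` shares with `x`, and `z` can spare `e`.
      rcases hsat x hx e with ⟨hFe, x', hx', hsb⟩ | ⟨x', hx', hb⟩
      · refine ⟨⟨x', hx', hsb.trans ?_⟩, ?_⟩
        · intro f hf
          simp only [reverse_apply]
          rw [hxz f hf]
        · intro f hf
          by_cases hfe : f = e
          · exact hfe ▸ hFe
          · rw [reverse_of_notMem (by simpa using hfe)] at hf
            exact hFz f hf
      · have := hb.not_surplus (hx'.trans hxz) hzf
        omega
  · rintro ⟨⟨x, hx, hxy⟩, h⟩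
    exact reach_of_agree h₀ _ x y rfl hy (hL x hx) hxy fun e he => hF e (h e he)

omit [DecidableEq V] in
/-- A list of orientations that pairwise differ on the blue edges has at most `2 ^ k` entries, where
`k` is the number of blue edges. -/
theorem length_le_of_pairwise {L : List (E → Bool)}
    (hL : L.Pairwise fun x y => ¬ N.SameBlue x y) :
    L.length ≤ 2 ^ (Finset.univ.filter (fun e => N.wt e = 2)).card := by
  have hnd : (L.map fun x => (Finset.univ.filter (fun e => N.wt e = 2)).filter
      (fun e => x e = true)).Nodup := by
    rw [List.Nodup, List.pairwise_map]
    refine hL.imp ?_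
    intro x y hxy heq
    refine hxy fun e he => ?_
    have := congrArg (fun S => e ∈ S) heq
    simp only [Finset.mem_filter, Finset.mem_univ, true_and, he, eq_iff_iff] at this
    rwa [Bool.eq_iff_iff]
  rw [← Finset.card_powerset, ← List.length_map (as := L), ← List.toFinset_card_of_nodup hnd]
  refine Finset.card_le_card fun S hS => ?_
  rw [List.mem_toFinset, List.mem_map] at hS
  obtain ⟨x, -, rfl⟩ := hS
  rw [Finset.mem_powerset]
  exact Finset.filter_subset _ _

end Network

/-! ## A program logic for the random access machine -/

infixr:60 " ;; " => Program.seq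

/-- The content of the first cell of an array. -/
abbrev Expr.var (a : ℕ) : Expr := .read a (.const 0)

/-- Assignment to the first cell of an array. -/
abbrev Program.assign (a : ℕ) (x : Expr) : Program := .write a (.const 0) x

/-- Repeat `P` with cell `0` of array `i` running from `0` up to `b`. -/
def Program.for (i : ℕ) (b : Expr) (P : Program) : Program :=
  .assign i (.const 0) ;; .loop (.minus b (.var i)) (P ;; .assign i (.plus (.var i) (.const 1)))

/-- The arrays that a program may change. -/
def Program.writes : Program → List ℕ
  | .skip => []
  | .write a _ _ => [a]
  | .seq P Q => P.writes ++ Q.writes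
  | .cond _ P Q => P.writes ++ Q.writes
  | .loop _ P => P.writes

/-- Each procedure changes only the arrays it mentions as targets, so facts about other arrays
survive. The side condition is a membership in a concrete list and is mostly settled by `decide`. -/
theorem Runs.frame {P : Program} {s s' : State} {t : ℕ} (h : Runs P s t s') {a : ℕ}
    (ha : a ∉ P.writes) : s' a = s a := by
  induction h with
  | skip => rfl
  | write b i x s =>
    rw [Function.update_of_ne]
    simpa [Program.writes] using ha
  | seq _ _ ihP ihQ =>
    simp only [Program.writes, List.mem_append, not_or] at ha
    rw [ihQ ha.2, ihP ha.1]
  | cond_true _ _ ihP =>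
    simp only [Program.writes, List.mem_append, not_or] at ha
    exact ihP ha.1
  | cond_false _ _ ihQ =>
    simp only [Program.writes, List.mem_append, not_or] at ha
    exact ihQ ha.2
  | loop_true _ _ _ ihP ihL => rw [ihL ha, ihP ha]
  | loop_false _ => rfl

/-- Started in `s`, the program `P` halts within `T` steps in a state that satisfies `Q`. -/
def Ends (P : Program) (s : State) (T : ℕ) (Q : State → Prop) : Prop :=
  ∃ t s', Runs P s t s' ∧ t ≤ T ∧ Q s'

namespace Ends

variable {P P' : Program} {s : State} {T T₁ T₂ : ℕ} {Q R : State → Prop}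

theorem mono (h : Ends P s T₁ R) (hT : T₁ ≤ T) (hQ : ∀ s', R s' → Q s') : Ends P s T Q := by
  obtain ⟨t, s', hr, ht, hs⟩ := h
  exact ⟨t, s', hr, ht.trans hT, hQ s' hs⟩

theorem le (h : Ends P s T₁ Q) (hT : T₁ ≤ T) : Ends P s T Q := h.mono hT fun _ h => h

theorem frame (h : Ends P s T Q) :
    Ends P s T (fun s' => Q s' ∧ ∀ a, a ∉ P.writes → s' a = s a) := by
  obtain ⟨t, s', hr, ht, hs⟩ := h
  exact ⟨t, s', hr, ht, hs, fun a ha => hr.frame ha⟩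

theorem skip (h : Q s) (hT : 1 ≤ T := by decide) : Ends .skip s T Q := ⟨1, s, .skip s, hT, h⟩

theorem write {a : ℕ} {i x : Expr}
    (h : Q (Function.update s a (Function.update (s a) (i.eval s) (x.eval s))))
    (hT : i.cost + x.cost + 1 ≤ T := by decide) : Ends (.write a i x) s T Q :=
  ⟨_, _, .write a i x s, hT, h⟩

theorem seq (hP : Ends P s T₁ R) (hQ : ∀ s', R s' → Ends P' s' T₂ Q) :
    Ends (P ;; P') s (T₁ + T₂) Q := by
  obtain ⟨t, s', hr, ht, hs⟩ := hP
  obtain ⟨t', s'', hr', ht', hs'⟩ := hQ s' hs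
  exact ⟨_, _, .seq hr hr', by omega, hs'⟩

theorem write_seq {a : ℕ} {i x : Expr}
    (h : Ends P (Function.update s a (Function.update (s a) (i.eval s) (x.eval s))) T Q) :
    Ends (.write a i x ;; P) s (i.cost + x.cost + 1 + T) Q :=
  seq (R := fun s' => s' = _) (write rfl le_rfl) (by rintro _ rfl; exact h)

/-- The sum of the two bounds covers either branch and keeps the cost arithmetic free of maxima. -/
theorem cond {b : Expr} (hP : b.eval s ≠ 0 → Ends P s T₁ Q) (hQ : b.eval s = 0 → Ends P' s T₂ Q) :
    Ends (.cond b P P') s (b.cost + 1 + (T₁ + T₂)) Q := by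
  by_cases hb : b.eval s = 0
  · obtain ⟨t, s', hr, ht, hs⟩ := hQ hb
    exact ⟨_, _, .cond_false hb hr, by omega, hs⟩
  · obtain ⟨t, s', hr, ht, hs⟩ := hP hb
    exact ⟨_, _, .cond_true hb hr, by omega, hs⟩

/-- The variant `μ` decreases in every round, so its initial value bounds the number of rounds. The
frame condition is handed to the body, so `I` need only mention what the body changes. -/
theorem loop {b : Expr} {I : State → Prop} (μ : State → ℕ)
    (hP : ∀ s', (∀ a, a ∉ P.writes → s' a = s a) → I s' → b.eval s' ≠ 0 →
      Ends P s' T (fun s'' => I s'' ∧ μ s'' < μ s')) (h0 : I s) {M : ℕ} (hM : μ s ≤ M) :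
    Ends (.loop b P) s (M * (b.cost + 1 + T) + (b.cost + 1))
      (fun s' => I s' ∧ b.eval s' = 0 ∧ ∀ a, a ∉ P.writes → s' a = s a) := by
  induction M generalizing s with
  | zero =>
    by_cases hb : b.eval s = 0
    · exact ⟨_, _, .loop_false hb, by omega, h0, hb, fun _ _ => rfl⟩
    · obtain ⟨t, s', hr, ht, hI', hlt⟩ := hP s (fun _ _ => rfl) h0 hb
      omega
  | succ M ih =>
    by_cases hb : b.eval s = 0
    · exact ⟨_, _, .loop_false hb, by omega, h0, hb, fun _ _ => rfl⟩
    · obtain ⟨t, s', hr, ht, hI', hlt⟩ := hP s (fun _ _ => rfl) h0 hb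
      have hf : ∀ a, a ∉ P.writes → s' a = s a := fun a ha => hr.frame ha
      obtain ⟨t', s'', hr', ht', hs, hb', hf'⟩ := ih
        (fun s₁ h₁ => hP s₁ fun a ha => (h₁ a ha).trans (hf a ha)) hI' (by omega)
      refine ⟨_, _, .loop_true hb hr hr', ?_, hs, hb', fun a ha => (hf' a ha).trans (hf a ha)⟩
      rw [Nat.succ_mul]
      omega

/-- The rule for `Program.for`, with an invariant `I k` that holds after `k` rounds. -/
theorem for_ {i : ℕ} {b : Expr} {I : ℕ → State → Prop} (N : ℕ)
    (hi : i ∉ P.writes)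
    (hI : ∀ k s s', (∀ a, a ≠ i → s' a = s a) → I k s → I k s')
    (hb : ∀ s', (∀ a, a ≠ i → a ∉ P.writes → s' a = s a) → b.eval s' = N)
    (h0 : I 0 s)
    (hP : ∀ k s', k < N → s' i 0 = k → (∀ a, a ≠ i → a ∉ P.writes → s' a = s a) → I k s' →
      Ends P s' T (I (k + 1))) :
    Ends (.for i b P) s (N * (b.cost + 10 + T) + (b.cost + 10))
      (fun s' => I N s' ∧ ∀ a, a ≠ i → a ∉ P.writes → s' a = s a) := by
  have hupd : ∀ (s : State) (f : ℕ → ℕ) (a : ℕ), a ≠ i → (Function.update s i f) a = s a :=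
    fun s f a ha => Function.update_of_ne ha _ _
  unfold Program.for
  refine mono (write_seq (loop (T := T + 6) (M := N)
    (I := fun s' => s' i 0 ≤ N ∧ I (s' i 0) s' ∧ ∀ a, a ≠ i → a ∉ P.writes → s' a = s a)
    (fun s => N - s i 0) ?_ ?_ ?_)) ?_ ?_
  · rintro s₁ - ⟨hle, hs, hf⟩ hne
    simp only [Expr.eval, hb _ hf] at hne
    have hbody := (hP _ s₁ (by omega) rfl hf hs).frame
    refine mono (seq hbody (T₂ := 6) (Q := fun s' => s' i 0 = s₁ i 0 + 1 ∧ I (s₁ i 0 + 1) s' ∧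
      ∀ a, a ≠ i → a ∉ P.writes → s' a = s a) ?_) le_rfl ?_
    · rintro s₂ ⟨h₁, hf₂⟩
      refine write ?_ le_rfl
      have h2 := hf₂ i hi
      refine ⟨by simp [Expr.eval, h2], hI _ _ _ (hupd _ _) h₁, ?_⟩
      intro a ha ha'
      rw [hupd _ _ _ ha, hf₂ a ha', hf a ha ha']
    · rintro s₃ ⟨h₁, h₂, h₃⟩
      rw [h₁]
      exact ⟨⟨by omega, h₂, h₃⟩, by omega⟩
  · refine ⟨by simp [Expr.eval], ?_, fun a ha _ => hupd _ _ _ ha⟩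
    simp only [Expr.eval, Function.update_self]
    exact hI _ _ _ (hupd _ _) h0
  · simp
  · simp only [Expr.cost]
    have : N * (b.cost + (1 + 1) + 1 + 1 + (T + 6)) = N * (b.cost + 10 + T) := by ring
    omega
  · rintro s' ⟨⟨h₁, h₂, h₄⟩, h₃, -⟩
    simp only [Expr.eval, hb _ h₄] at h₃
    have : s' i 0 = N := by omega
    rw [this] at h₂
    exact ⟨h₂, h₄⟩

end Ends

/-! ## Conditions -/

/-- Nonzero if and only if the values of `a` and `b` differ. -/
def Expr.ne (a b : Expr) : Expr := .plus (.minus a b) (.minus b a)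

/-- Nonzero if and only if the values of `a` and `b` are nonzero. -/
def Expr.and (a b : Expr) : Expr := .minus a (.minus a b)

theorem Expr.eval_ne {s : State} {a b : Expr} :
    (Expr.ne a b).eval s = 0 ↔ a.eval s = b.eval s := by
  simp only [Expr.ne, Expr.eval]
  omega

/-- The truncated difference `a - (a - b)` is the minimum of `a` and `b`. -/
theorem Expr.eval_and {s : State} {a b : Expr} :
    (Expr.and a b).eval s = 0 ↔ a.eval s = 0 ∨ b.eval s = 0 := by
  simp only [Expr.and, Expr.eval]
  omega

/-! ## The procedures

Memory layout. Arrays `0` to `5` hold the input. Array `6` holds the reference orientation, the head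
of `e` in cell `2 e` and the tail in cell `2 e + 1`. Array `7` holds the current orientation, array
`8` a list of orientations in blocks of `m + 1` cells, array `9` marks edges that can be reversed.
Arrays `10` and `11` hold the levels and the parent edges of a search tree. The other arrays are
used for single numbers: `12`, `17`, `22` count edges, vertices and edges, `13` is the root of the
search, `14` is zero or the successor of a vertex with surplus, `15` a vertex on the path to the
root, `16` a load, `18` a missing load, `19` tells that it cannot be provided, `20`, `21`, `23` are
addresses in the list (the current block, its end, and the block to compare with), `24` and `25`
hold the results of comparisons, `26` is the length of a block, `27` is an edge. -/

namespace Program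

/-- The number of vertices. -/
abbrev numVertices : Expr := .read 0 (.const 0)

/-- The number of edges. -/
abbrev numEdges : Expr := .read 0 (.const 1)

/-- The head of an edge in the current orientation. -/
abbrev headOf (e : Expr) : Expr := .read 6 (.plus (.plus e e) (.read 7 e))

/-- The tail of an edge in the current orientation. -/
abbrev tailOf (e : Expr) : Expr := .read 6 (.plus (.plus e e) (.minus (.const 1) (.read 7 e)))

/-- Reverse an edge of the current orientation. -/
abbrev flip (e : Expr) : Program := .write 7 e (.minus (.const 1) (.read 7 e))

/-- Copy the current block of the list to the current orientation. -/
def copy : Program :=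
  .for 12 numEdges (.write 7 (.var 12) (.read 8 (.plus (.var 20) (.var 12))))

/-- Compute the load of vertex `17`. -/
def computeLoad : Program :=
  .assign 16 (.const 0) ;;
  .for 12 numEdges (.cond (.ne (headOf (.var 12)) (.var 17)) .skip
    (.assign 16 (.plus (.var 16) (.read 1 (.var 12)))))

/-- The edge `12` is red and leaves the search tree. -/
def leaves : Expr :=
  .and (.minus (.const 2) (.read 1 (.var 12))) (.and (.read 10 (tailOf (.var 12)))
    (.minus (.const 1) (.read 10 (headOf (.var 12)))))

/-- Grow a tree of red arcs from vertex `13`. -/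
def search : Program :=
  .for 17 numVertices (.write 10 (.var 17) (.const 0)) ;;
  .write 10 (.var 13) (.const 1) ;;
  .assign 12 (.const 0) ;;
  .loop (.minus numEdges (.var 12))
    (.cond leaves
      (.write 11 (headOf (.var 12)) (.var 12) ;;
        .write 10 (headOf (.var 12)) (.plus (.read 10 (tailOf (.var 12))) (.const 1)) ;;
        .assign 12 (.const 0))
      (.assign 12 (.plus (.var 12) (.const 1))))

/-- Find a vertex with surplus in the search tree, other than the root. -/
def findSurplus : Program :=
  .assign 14 (.const 0) ;;
  .for 17 numVertices
    (.cond (.and (.read 10 (.var 17)) (.ne (.var 17) (.var 13)))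
      (computeLoad ;; .cond (.minus (.var 16) (.const 2)) (.assign 14 (.plus (.var 17) (.const 1)))
        .skip)
      .skip)

/-- Reverse the path from the root of the search tree to the vertex with surplus. -/
def shift : Program :=
  .assign 15 (.minus (.var 14) (.const 1)) ;;
  .loop (.minus (.read 10 (.var 15)) (.const 1))
    -- The tail is read before the flip turns it into the head.
    (.assign 27 (.read 11 (.var 15)) ;; .assign 15 (tailOf (.var 27)) ;; flip (.var 27))

/-- Increase the load of vertex `13` by one, if possible. -/
def augment : Program := search ;; findSurplus ;; .cond (.var 14) shift .skip

/-- Increase the load of the head of edge `22` until it does not need that edge, if possible. -/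
def gain : Program :=
  .assign 13 (headOf (.var 22)) ;; .assign 17 (.var 13) ;; computeLoad ;;
  .assign 18 (.minus (.plus (.const 2) (.read 1 (.var 22))) (.var 16)) ;;
  .assign 19 (.const 0) ;;
  .loop (.var 18) (augment ;; .cond (.var 14) (.assign 18 (.minus (.var 18) (.const 1)))
    (.assign 18 (.const 0) ;; .assign 19 (.const 1)))

/-- Test whether the list contains an orientation that agrees with the current one on the blue
edges. -/
def lookup : Program :=
  .assign 25 (.const 0) ;; .assign 23 (.const 0) ;;
  .loop (.minus (.var 21) (.var 23))
    (.assign 24 (.const 0) ;;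
      .for 12 numEdges (.cond (.and (.minus (.read 1 (.var 12)) (.const 1))
        (.ne (.read 8 (.plus (.var 23) (.var 12))) (.read 7 (.var 12)))) (.assign 24 (.const 1))
          .skip) ;;
      .cond (.var 24) .skip (.assign 25 (.const 1)) ;;
      .assign 23 (.plus (.var 23) (.var 26)))

/-- Append the current orientation to the list. -/
def append : Program :=
  .for 12 numEdges (.write 8 (.plus (.var 21) (.var 12)) (.read 7 (.var 12))) ;;
  .assign 21 (.plus (.var 21) (.var 26))

/-- Try to reverse edge `22`, starting from the current block of the list. -/
def tryEdge : Program :=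
  copy ;; gain ;; .cond (.var 19) .skip
    (flip (.var 22) ;; .write 9 (.var 22) (.const 1) ;; lookup ;; .cond (.var 25) .skip append)

/-- Store the reference orientation. -/
def setup : Program :=
  -- The extra cell keeps blocks nonempty when there are no edges, so that loops over addresses
  -- always advance.
  .assign 26 (.plus numEdges (.const 1)) ;; .assign 21 (.var 26) ;;
  .for 12 numEdges (.write 6 (.plus (.var 12) (.var 12)) (.read 3 (.var 12)) ;;
    .write 6 (.plus (.plus (.var 12) (.var 12)) (.const 1)) (.read 2 (.var 12)))

/-- Generate the list of orientations that can be reached. -/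
def explore : Program :=
  .loop (.minus (.var 21) (.var 20))
    (.for 22 numEdges tryEdge ;; .assign 20 (.plus (.var 20) (.var 26)))

/-- Test whether the target orientation can be reached. -/
def decideTarget : Program :=
  .for 12 numEdges (.cond (.ne (.read 5 (.var 12)) (.read 3 (.var 12)))
    (.write 7 (.var 12) (.const 1)) (.write 7 (.var 12) (.const 0))) ;;
  lookup ;;
  .for 12 numEdges (.cond (.and (.read 7 (.var 12)) (.minus (.const 1) (.read 9 (.var 12))))
    (.assign 25 (.const 0)) .skip) ;;
  .assign 0 (.var 25)

/-- The decision procedure for C2C. -/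
def solve : Program := setup ;; explore ;; decideTarget

end Program

/-! ## Correctness of the procedures -/

variable {n m : ℕ}

/-- The memory holds the network `N`. -/
structure Network.Holds (N : Network (Fin n) (Fin m)) (s : State) : Prop where
  vertices : s 0 0 = n
  edges : s 0 1 = m
  weight : ∀ e : Fin m, s 1 e = N.wt e
  heads : ∀ e : Fin m, s 6 (e + e) = N.hd e
  tails : ∀ e : Fin m, s 6 (e + e + 1) = N.tl e

/-- The array `f` holds the orientation `x`. -/
def Encodes (f : ℕ → ℕ) (x : Fin m → Bool) : Prop := ∀ e : Fin m, f e = (x e).toNat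

variable {N : Network (Fin n) (Fin m)} {s : State} {x : Fin m → Bool}

theorem Network.Holds.congr {s' : State} (h : N.Holds s) (h0 : s' 0 = s 0) (h1 : s' 1 = s 1)
    (h6 : s' 6 = s 6) : N.Holds s' := by
  refine ⟨?_, ?_, ?_, ?_, ?_⟩ <;> simp only [h0, h1, h6]
  exacts [h.vertices, h.edges, h.weight, h.heads, h.tails]

theorem eval_headOf (h : N.Holds s) (hx : Encodes (s 7) x) {e : Expr} {f : Fin m}
    (he : e.eval s = f) : (Program.headOf e).eval s = N.head x f := by
  simp only [Expr.eval, he, hx f, Network.head]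
  cases x f
  · simpa using h.heads f
  · simpa using h.tails f

theorem eval_tailOf (h : N.Holds s) (hx : Encodes (s 7) x) {e : Expr} {f : Fin m}
    (he : e.eval s = f) : (Program.tailOf e).eval s = N.tail x f := by
  simp only [Expr.eval, he, hx f, Network.tail]
  cases x f
  · simpa using h.tails f
  · simpa using h.heads f

theorem encodes_flip {f g : ℕ → ℕ} (hx : Encodes f x) (e : Fin m)
    (hg : g = Function.update f e (1 - f e)) : Encodes g (Network.reverse {e} x) := by
  intro e'
  subst hg
  by_cases h : e' = e
  · subst h
    rw [Function.update_self, hx e', Network.reverse_of_mem (by simp)]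
    cases x e' <;> rfl
  · rw [Function.update_of_ne (by rwa [Ne, Fin.val_inj]), hx e',
      Network.reverse_of_notMem (by simpa using h)]

theorem copy_spec (h : N.Holds s) (hx : ∀ e : Fin m, s 8 (s 20 0 + e) = (x e).toNat) :
    Ends Program.copy s (50 * (m + 1)) (fun s' => Encodes (s' 7) x) := by
  refine (Ends.for_ (T := 20) (I := fun k s' => ∀ e : Fin m, e < k → s' 7 e = (x e).toNat) m ?_ ?_ ?_ ?_
    ?_).mono ?_ ?_
  · simp [Program.writes]
  · intro k s s' hs
    simp [hs]
  · intro s' hs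
    simp [Expr.eval, hs, Program.writes, h.edges]
  · simp
  · intro k s' hk hs' hf hI
    refine Ends.write ?_
    intro e he
    simp only [Expr.eval, hs', Function.update_self]
    by_cases hek : (e : ℕ) = k
    · rw [← hek, Function.update_self, ← hx e]
      simp [hf, Program.writes]
    · rw [Function.update_of_ne hek]
      exact hI e (by omega)
  · simp only [Expr.cost]
    omega
  · rintro s' ⟨hs', -⟩ e
    exact hs' e e.2

theorem sum_filter_lt_succ (f : Fin m → ℕ) (k : Fin m) :
    ∑ e with e.1 < k.1 + 1, f e = (∑ e with e.1 < k.1, f e) + f k := by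
  have : Finset.univ.filter (fun e : Fin m => e.1 < k.1 + 1) =
      insert k (Finset.univ.filter (fun e : Fin m => e.1 < k.1)) := by
    ext e
    simp only [Finset.mem_filter, Finset.mem_univ, true_and, Finset.mem_insert, Fin.ext_iff]
    omega
  rw [this, Finset.sum_insert (by simp), add_comm]

theorem computeLoad_spec (h : N.Holds s) (hx : Encodes (s 7) x) {u : Fin n} (hu : s 17 0 = u) :
    Ends Program.computeLoad s (100 * (m + 1)) (fun s' => s' 16 0 = N.load x u) := by
  refine (Ends.write_seq (Ends.for_ (T := 50) (I := fun k s' => s' 16 0 =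
    ∑ e : Fin m with e.1 < k, if N.head x e = u then N.wt e else 0) m ?_ ?_ ?_ ?_ ?_)).mono ?_ ?_
  · simp [Program.writes]
  · intro k s s' hs
    simp [hs]
  · intro s' hs
    simp [Expr.eval, hs, Program.writes, h.edges]
  · simp [Expr.eval]
  · intro k s' hk hs' hf hI
    simp only [Program.writes, List.nil_append, List.mem_singleton] at hf
    have h' : N.Holds s' := h.congr (by simp [hf]) (by simp [hf]) (by simp [hf])
    have hx' : Encodes (s' 7) x := by simpa [hf] using hx
    have hhead := eval_headOf h' hx' (e := .var 12) (f := ⟨k, hk⟩) (by simp [Expr.eval, hs'])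
    have hu' : s' 17 0 = u := by simpa [hf] using hu
    have hsum := sum_filter_lt_succ (fun e => if N.head x e = u then N.wt e else 0) ⟨k, hk⟩
    refine (Ends.cond (T₁ := 1) (T₂ := 10) ?_ ?_).le (by decide)
    · intro hne
      rw [Ne, Expr.eval_ne, hhead] at hne
      simp only [Expr.eval, hu', Fin.val_inj] at hne
      refine Ends.skip ?_
      rw [hsum, if_neg hne, add_zero]
      exact hI
    · intro heq
      rw [Expr.eval_ne, hhead] at heq
      simp only [Expr.eval, hu', Fin.val_inj] at heq
      refine Ends.write ?_
      rw [hsum, if_pos heq]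
      simp only [Expr.eval, Function.update_self, hs', hI]
      rw [← h'.weight ⟨k, hk⟩]
  · simp only [Expr.cost]
    omega
  · rintro s' ⟨hs', -⟩
    rw [hs', Network.load]
    refine Finset.sum_congr ?_ fun _ _ => rfl
    ext e
    simp

/-! ### Search trees and the augmentation of loads -/

/-- The number of vertices with a nonzero level. -/
def reached (n : ℕ) (d : ℕ → ℕ) : ℕ := (Finset.univ.filter (fun u : Fin n => d u ≠ 0)).card

theorem reached_le (d : ℕ → ℕ) : reached n d ≤ n := by
  exact (Finset.card_filter_le _ _).trans (by simp)

theorem reached_update {d : ℕ → ℕ} {u : Fin n} (hu : d u = 0) (k : ℕ) :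
    reached n (Function.update d u (k + 1)) = reached n d + 1 := by
  unfold reached
  have : Finset.univ.filter (fun u' : Fin n => Function.update d u (k + 1) u' ≠ 0) =
      insert u (Finset.univ.filter (fun u' : Fin n => d u' ≠ 0)) := by
    ext u'
    by_cases h : u' = u
    · simp [h]
    · simp [h, Function.update_of_ne (Fin.val_ne_of_ne h)]
  rw [this, Finset.card_insert_of_notMem (by simp [hu])]

/-- The levels `d` and the parent edges `p` describe a tree of red arcs with root `v`. -/
structure SearchTree (N : Network (Fin n) (Fin m)) (x : Fin m → Bool) (v : Fin n)
    (d p : ℕ → ℕ) : Prop where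
  root : d v = 1
  eq_root : ∀ u : Fin n, d u = 1 → u = v
  parent : ∀ u : Fin n, 2 ≤ d u → ∃ e : Fin m, p u = e ∧ N.wt e = 1 ∧ N.head x e = u ∧
    d (N.tail x e) ≠ 0 ∧ d (N.tail x e) < d u
  le_reached : ∀ u : Fin n, d u ≤ reached n d

/-- The new vertex had level zero, so the entries of old tree vertices are untouched. Its level
exceeds that of its parent by one, as the number of reached vertices grows by one; this keeps all
levels, and hence tree paths, at length at most `n`. -/
theorem SearchTree.insert {v : Fin n} {d p : ℕ → ℕ} (h : SearchTree N x v d p) {e : Fin m}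
    (he : N.wt e = 1) (ht : d (N.tail x e) ≠ 0) (hh : d (N.head x e) = 0) :
    SearchTree N x v (Function.update d (N.head x e) (d (N.tail x e) + 1))
      (Function.update p (N.head x e) e) := by
  have hne : ∀ u : Fin n, d u ≠ 0 → (u : ℕ) ≠ N.head x e := by
    intro u hu hu'
    rw [hu'] at hu
    exact hu hh
  refine ⟨?_, ?_, ?_, ?_⟩
  · rw [Function.update_of_ne (hne v (by simp [h.root])), h.root]
  · intro u hu
    by_cases huh : (u : ℕ) = N.head x e
    · rw [huh, Function.update_self] at hu
      omega
    · rw [Function.update_of_ne huh] at hu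
      exact h.eq_root u hu
  · intro u hu
    by_cases huh : (u : ℕ) = N.head x e
    · refine ⟨e, ?_, he, (Fin.ext huh).symm, ?_, ?_⟩
      · rw [huh, Function.update_self]
      · rwa [Function.update_of_ne (hne _ ht)]
      · rw [Function.update_of_ne (hne _ ht), huh, Function.update_self]
        omega
    · rw [Function.update_of_ne huh] at hu ⊢
      obtain ⟨f, h₁, h₂, h₃, h₄, h₅⟩ := h.parent u hu
      refine ⟨f, ?_, h₂, h₃, ?_, ?_⟩
      · exact h₁
      · rwa [Function.update_of_ne (hne _ h₄)]
      · rwa [Function.update_of_ne (hne _ h₄), Function.update_of_ne huh]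
  · intro u
    rw [reached_update hh]
    by_cases huh : (u : ℕ) = N.head x e
    · rw [huh, Function.update_self]
      have := h.le_reached (N.tail x e)
      omega
    · rw [Function.update_of_ne huh]
      have := h.le_reached u
      omega

theorem eval_leaves (h : N.Holds s) (hx : Encodes (s 7) x) {e : Fin m} (he : s 12 0 = e) :
    Program.leaves.eval s ≠ 0 ↔
      N.wt e = 1 ∧ s 10 (N.tail x e) ≠ 0 ∧ s 10 (N.head x e) = 0 := by
  have he' : (Expr.var 12).eval s = e := by simp [Expr.eval, he]
  have h₁ : (Expr.read 10 (Program.tailOf (.var 12))).eval s = s 10 (N.tail x e) := by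
    rw [Expr.eval, eval_tailOf h hx he']
  have h₂ : (Expr.read 10 (Program.headOf (.var 12))).eval s = s 10 (N.head x e) := by
    rw [Expr.eval, eval_headOf h hx he']
  have h₃ : (Expr.read 1 (.var 12)).eval s = N.wt e := by
    rw [Expr.eval, he', h.weight]
  -- As weights are one or two, `2 - wt e` is nonzero exactly for red edges.
  have hw := N.wt_eq e
  rw [Program.leaves, Ne, Expr.eval_and, Expr.eval_and, Expr.eval.eq_4, Expr.eval.eq_4, h₁, h₂, h₃]
  simp only [Expr.eval]
  omega

theorem search_spec (h : N.Holds s) (hx : Encodes (s 7) x) {v : Fin n} (hv : s 13 0 = v) :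
    Ends Program.search s (500 * (n + 2) * (m + 1)) (fun s' => SearchTree N x v (s' 10) (s' 11) ∧
      ∀ e, N.wt e = 1 → s' 10 (N.tail x e) ≠ 0 → s' 10 (N.head x e) ≠ 0) := by
  have hclear : Ends (.for 17 Program.numVertices (.write 10 (.var 17) (.const 0))) s (n * 30 + 20)
      (fun s' => (∀ u : Fin n, (u : ℕ) < n → s' 10 u = 0) ∧
        ∀ a, a ≠ 17 → a ∉ [10] → s' a = s a) := by
    refine (Ends.for_ (T := 10) (I := fun k s' => ∀ u : Fin n, (u : ℕ) < k → s' 10 u = 0) n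
      ?_ ?_ ?_ ?_ ?_).mono ?_ fun _ h => h
    · simp [Program.writes]
    · intro k s s' hs
      simp [hs]
    · intro s' hs
      simp [Expr.eval, hs, Program.writes, h.vertices]
    · simp
    · intro k s' hk hs' hf hI
      refine Ends.write ?_
      intro u hu
      simp only [Expr.eval, hs', Function.update_self]
      by_cases huk : (u : ℕ) = k
      · rw [← huk, Function.update_self]
      · rw [Function.update_of_ne huk]
        exact hI u (by omega)
    · simp only [Expr.cost]
      omega
  refine (Ends.seq hclear (T₂ := 20 + ((n + 1) * (m + 1) * 300 + 20)) ?_).le ?_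
  · rintro s₁ ⟨hs₁, hf₁⟩
    simp only [List.mem_singleton] at hf₁
    refine (Ends.write_seq (Ends.write_seq (T := (n + 1) * (m + 1) * 300 + 20) ((Ends.loop (T := 200) (M := (n + 1) * (m + 1))
      (I := fun s' => SearchTree N x v (s' 10) (s' 11) ∧ s' 12 0 ≤ m ∧ ∀ e : Fin m, e < s' 12 0 →
        N.wt e = 1 → s' 10 (N.tail x e) ≠ 0 → s' 10 (N.head x e) ≠ 0)
      -- The scan restarts at edge zero after each insertion. This is a lexicographic potential: an
      -- insertion outweighs the reset of the counter, which is at most `m`.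
      (fun s' => (n - reached n (s' 10)) * (m + 1) + (m - s' 12 0)) ?_ ?_ ?_).mono ?_ ?_))).le ?_
    · rintro s₂ hf₂ ⟨hT, hle, hcl⟩ hlt
      simp only [Program.writes, List.cons_append, List.nil_append, List.mem_cons,
        List.not_mem_nil, or_false] at hf₂
      have h0 : s₂ 0 = s 0 := by simp [hf₂, hf₁]
      have h7 : s₂ 7 = s 7 := by simp [hf₂, hf₁]
      have h' : N.Holds s₂ := h.congr h0 (by simp [hf₂, hf₁]) (by simp [hf₂, hf₁])
      have hx' : Encodes (s₂ 7) x := by rwa [h7]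
      have hlt : s₂ 12 0 < m := by
        simp only [Expr.eval, h'.edges] at hlt
        omega
      obtain ⟨e, he⟩ : ∃ e : Fin m, s₂ 12 0 = e := ⟨⟨_, hlt⟩, rfl⟩
      have hlv := eval_leaves h' hx' he
      have he' : (Expr.var 12).eval s₂ = e := by simp [Expr.eval, he]
      refine (Ends.cond (T₁ := 70) (T₂ := 10) ?_ ?_).le (by decide)
      · intro hne
        obtain ⟨hw, ht, hh⟩ := hlv.1 hne
        have hr := reached_le (n := n) (Function.update (s₂ 10) (N.head x e)
          (s₂ 10 (N.tail x e) + 1))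
        have hr' := reached_update hh (s₂ 10 (N.tail x e))
        have hup : ∀ (a : ℕ) (f : ℕ → ℕ), a ≠ 6 → a ≠ 7 → a ≠ 12 → ∀ b,
            (b = Program.headOf (.var 12) ∨ b = Program.tailOf (.var 12)) →
            b.eval (Function.update s₂ a f) = b.eval s₂ := by
          intro a f h₁ h₂ h₃ b hb
          rcases hb with rfl | rfl <;>
          simp [Expr.eval, Function.update_of_ne h₁.symm, Function.update_of_ne h₂.symm,
            Function.update_of_ne h₃.symm]
        refine (Ends.write_seq (Ends.write_seq (Ends.write (T := 10) ?_))).le (by decide)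
        rw [Expr.eval.eq_3, Expr.eval.eq_2 _ 10, hup _ _ (by decide) (by decide) (by decide) _
          (.inl rfl), hup _ _ (by decide) (by decide) (by decide) _ (.inr rfl),
          eval_headOf h' hx' he', eval_tailOf h' hx' he', he']
        simp only [Expr.eval, ne_eq, Nat.reduceEqDiff, not_false_eq_true,
          Function.update_self, Function.update_of_ne]
        refine ⟨⟨hT.insert hw ht hh, Nat.zero_le _, fun e he => absurd he (Nat.not_lt_zero _)⟩, ?_⟩
        rw [hr'] at hr ⊢
        have : (n - reached n (s₂ 10)) = (n - (reached n (s₂ 10) + 1)) + 1 := by omega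
        rw [this, Nat.succ_mul]
        omega
      · intro heq
        refine Ends.write ?_
        simp only [Expr.eval, ne_eq, Nat.reduceEqDiff, not_false_eq_true,
          Function.update_self, Function.update_of_ne]
        refine ⟨⟨hT, hlt, fun e' he' hw ht hh => ?_⟩, by omega⟩
        by_cases hee : e' = e
        · subst hee
          exact hlv.2 ⟨hw, ht, hh⟩ heq
        · have := Fin.val_ne_of_ne hee
          exact hcl e' (by omega) hw ht hh
    · have h13 : s₁ 13 0 = v := by simp [hf₁, hv]
      simp only [Expr.eval, ne_eq, Nat.reduceEqDiff, not_false_eq_true,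
          Function.update_self, Function.update_of_ne, h13]
      have hd : ∀ u : Fin n, u ≠ v → Function.update (s₁ 10) v 1 u = 0 := by
        intro u hu
        rw [Function.update_of_ne (Fin.val_ne_of_ne hu), hs₁ u u.2]
      refine ⟨⟨Function.update_self _ _ _, ?_, ?_, ?_⟩, Nat.zero_le _,
        fun e he => absurd he (Nat.not_lt_zero _)⟩
      · intro u hu
        by_contra huv
        rw [hd u huv] at hu
        omega
      · intro u hu
        by_cases huv : u = v
        · rw [huv, Function.update_self] at hu
          omega
        · rw [hd u huv] at hu
          omega
      · intro u
        by_cases huv : u = v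
        · rw [reached_update (hs₁ v v.2) 0, huv, Function.update_self]
          omega
        · rw [hd u huv]
          omega
    · have : (n - reached n (s₁ 10)) * (m + 1) ≤ n * (m + 1) := Nat.mul_le_mul_right _ (by omega)
      simp only [Expr.eval, ne_eq, Nat.reduceEqDiff, not_false_eq_true,
          Function.update_self, Function.update_of_ne]
      rw [Nat.succ_mul]
      refine Nat.add_le_add (Nat.mul_le_mul_right _ (by omega)) (by omega)
    · simp only [Expr.cost]
      nlinarith
    · rintro s₃ ⟨⟨hT, hle, hcl⟩, hge, hf₃⟩
      have h0 : s₃ 0 1 = m := by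
        rw [hf₃ 0 (by simp [Program.writes])]
        simp [hf₁, h.edges]
      simp only [Expr.eval, h0] at hge
      exact ⟨hT, fun e => hcl e (by omega)⟩
    · simp only [Expr.cost]
      omega
  · nlinarith

theorem findSurplus_spec (h : N.Holds s) (hx : Encodes (s 7) x) {v : Fin n} (hv : s 13 0 = v) :
    Ends Program.findSurplus s (300 * (n + 1) * (m + 1)) (fun s' =>
      (s' 14 0 = 0 ∧ ∀ u : Fin n, s 10 u ≠ 0 → u ≠ v → N.load x u ≤ 2) ∨
      ∃ u : Fin n, s' 14 0 = u + 1 ∧ s 10 u ≠ 0 ∧ u ≠ v ∧ 3 ≤ N.load x u) := by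
  refine (Ends.write_seq (Ends.for_ (T := 150 * (m + 1)) (I := fun k s' =>
    (s' 14 0 = 0 ∧ ∀ u : Fin n, (u : ℕ) < k → s 10 u ≠ 0 → u ≠ v → N.load x u ≤ 2) ∨
    ∃ u : Fin n, s' 14 0 = u + 1 ∧ s 10 u ≠ 0 ∧ u ≠ v ∧ 3 ≤ N.load x u) n (by decide)
    ?_ ?_ ?_ ?_)).mono ?_ ?_
  · intro k s s' hs
    simp [hs]
  · intro s' hs
    rw [Expr.eval, hs 0 (by decide) (by decide)]
    simp [Expr.eval, h.vertices]
  · exact .inl ⟨by simp [Expr.eval], fun u hu => absurd hu (Nat.not_lt_zero _)⟩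
  · intro k s' hk hs' hf hI
    have hf' : ∀ a, a ≠ 17 → a ∉ [12, 14, 16] → s' a = s a := by
      intro a ha ha'
      rw [hf a ha (fun hm => ha' ?_), Function.update_of_ne]
      · rintro rfl
        exact ha' (by decide)
      · revert hm
        clear * -
        simp [Program.writes, Program.computeLoad, Program.for]
        tauto
    clear hf
    have h' : N.Holds s' := h.congr (hf' 0 (by decide) (by decide)) (hf' 1 (by decide) (by decide))
      (hf' 6 (by decide) (by decide))
    have hx' : Encodes (s' 7) x := by
      rw [hf' 7 (by decide) (by decide)]
      exact hx
    have h10 := hf' 10 (by decide) (by decide)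
    have h13 := hf' 13 (by decide) (by decide)
    have hb : (Expr.and (.read 10 (.var 17)) (.ne (.var 17) (.var 13))).eval s' = 0 ↔
        s 10 k = 0 ∨ k = (v : ℕ) := by
      rw [Expr.eval_and, Expr.eval_ne]
      simp only [Expr.eval, hs', h10, h13, hv]
    refine (Ends.cond (T₁ := 100 * (m + 1) + 25) (T₂ := 1) ?_ ?_).le ?_
    · intro hne
      rw [Ne, hb, not_or] at hne
      refine Ends.seq (computeLoad_spec h' hx' (u := ⟨k, hk⟩) hs').frame ?_
      rintro s₁ ⟨h₁, hf₁⟩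
      have h17 : s₁ 17 0 = k := by rw [hf₁ 17 (by decide), hs']
      have h14 : s₁ 14 0 = s' 14 0 := by rw [hf₁ 14 (by decide)]
      refine (Ends.cond (T₁ := 10) (T₂ := 1) ?_ ?_).le (by decide)
      · intro hlt
        simp only [Expr.eval, h₁] at hlt
        refine Ends.write (.inr ⟨⟨k, hk⟩, ?_, hne.1, fun hkv => hne.2 (by rw [← hkv]), by omega⟩)
        simp [Expr.eval, h17]
      · intro hle
        simp only [Expr.eval, h₁] at hle
        refine Ends.skip ?_
        rw [h14]
        refine hI.imp ?_ id
        rintro ⟨hI₁, hI₂⟩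
        refine ⟨hI₁, fun u hu => ?_⟩
        rcases Nat.lt_succ_iff_lt_or_eq.1 hu with hu | hu
        · exact hI₂ u hu
        · obtain rfl : u = ⟨k, hk⟩ := Fin.ext hu
          intros
          omega
    · intro heq
      rw [hb] at heq
      refine Ends.skip ?_
      refine hI.imp ?_ id
      rintro ⟨hI₁, hI₂⟩
      refine ⟨hI₁, fun u hu hu₁ hu₂ => ?_⟩
      rcases Nat.lt_succ_iff_lt_or_eq.1 hu with hu | hu
      · exact hI₂ u hu hu₁ hu₂
      · rw [← hu] at heq
        rcases heq with heq | heq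
        · exact absurd heq hu₁
        · exact absurd (Fin.ext heq) hu₂
    · simp only [Expr.cost, Expr.and, Expr.ne]
      omega
  · simp only [Expr.cost]
    nlinarith
  · rintro s' ⟨hs', -⟩
    refine hs'.imp ?_ id
    rintro ⟨h₁, h₂⟩
    exact ⟨h₁, fun u => h₂ u u.2⟩

/-- The surplus walks from `u` to the root, each step reversing the parent edge of the current
vertex `c`. Parent edges at levels up to that of `c` are still intact, because the reversed ones
belong to higher levels. No arc entering `v` is touched, so an edge whose head is to be relieved
keeps its direction. -/
theorem shift_spec (h : N.Holds s) (hx : Encodes (s 7) x) (hfeas : N.Feasible x) {v : Fin n}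
    (hT : SearchTree N x v (s 10) (s 11)) {u : Fin n} (hu : s 14 0 = u + 1) (hu0 : s 10 u ≠ 0)
    (huv : u ≠ v) (hload : 3 ≤ N.load x u) :
    Ends Program.shift s (100 * (n + 1)) (fun s' => ∃ x', Encodes (s' 7) x' ∧ N.Reach x x' ∧
      N.SameBlue x' x ∧ N.load x' v = N.load x v + 1 ∧ ∀ f, N.head x f = v → x' f = x f) := by
  refine (Ends.write_seq (Ends.loop (T := 50) (M := n)
    (I := fun s' => ∃ (x' : Fin m → Bool) (c : Fin n), Encodes (s' 7) x' ∧ s' 15 0 = c ∧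
      s 10 c ≠ 0 ∧ N.Reach x x' ∧ N.SameBlue x' x ∧ 3 ≤ N.load x' c ∧
      (∀ f, N.head x f = v → x' f = x f) ∧
      N.load x' v = N.load x v + (if c = v then 1 else 0) ∧
      ∀ u : Fin n, 2 ≤ s 10 u → s 10 u ≤ s 10 c → ∃ e : Fin m, s 11 u = e ∧ N.wt e = 1 ∧
        N.head x' e = u ∧ s 10 (N.tail x' e) ≠ 0 ∧ s 10 (N.tail x' e) < s 10 u)
    (fun s' => s 10 (s' 15 0)) ?_ ?_ ?_)).mono ?_ ?_
  · rintro s₁ hf₁ ⟨x', c, hx', hc, hc0, hreach, hsame, hload, hroot, hv, hpar⟩ hne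
    have hf : ∀ a, a ∉ [7, 15, 27] → s₁ a = s a := by
      intro a ha
      rw [hf₁ a (fun hm => ha ?_), Function.update_of_ne]
      · rintro rfl
        exact ha (by decide)
      · revert hm
        simp [Program.writes]
        tauto
    clear hf₁
    have h10 := hf 10 (by decide)
    have h11 := hf 11 (by decide)
    have h' : N.Holds s₁ := h.congr (hf 0 (by decide)) (hf 1 (by decide)) (hf 6 (by decide))
    simp only [Expr.eval, hc, h10] at hne
    obtain ⟨e, he, hwe, hhe, hte, hlt⟩ := hpar c (by omega) le_rfl
    have hcv : c ≠ v := by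
      rintro rfl
      rw [hT.root] at hne
      omega
    have hsur : 2 + N.wt e ≤ N.load x' (N.head x' e) := by
      rw [hhe, hwe]
      omega
    have hx'f := hreach.feasible hfeas
    refine (Ends.write_seq (Ends.write_seq (Ends.write (T := 15) ?_))).le (by decide)
    have he₁ : (Expr.read 11 (.var 15)).eval s₁ = e := by simp [Expr.eval, hc, h11, he]
    rw [he₁]
    simp only [Expr.eval]
    set s₂ := Function.update s₁ 27 (Function.update (s₁ 27) 0 (e : ℕ)) with hs₂
    have h27 : s₂ 27 0 = e := by simp [hs₂]
    have hup : ∀ a, a ≠ 27 → s₂ a = s₁ a := fun a ha => Function.update_of_ne ha _ _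
    have htail := eval_tailOf (h'.congr (hup 0 (by decide)) (hup 1 (by decide)) (hup 6 (by decide)))
      (e := .var 27) (f := e) (by rw [hup 7 (by decide)]; exact hx') h27
    simp only [Expr.eval] at htail
    rw [htail]
    simp only [ne_eq, Nat.reduceEqDiff, not_false_eq_true, Function.update_self,
      Function.update_of_ne, h27, hup]
    refine ⟨⟨Network.reverse {e} x', N.tail x' e, encodes_flip hx' e rfl, rfl, hte,
      hreach.tail ⟨e, hsur, rfl⟩, (N.sameBlue_reverse_red hwe x').trans hsame, ?_, ?_, ?_, ?_⟩, ?_⟩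
    · have := Network.load_tail_of_surplus hx'f hsur
      omega
    · intro f hf
      rw [Network.reverse_of_notMem, hroot f hf]
      rw [Finset.mem_singleton]
      rintro rfl
      rw [← N.head_congr (hroot f hf), hhe] at hf
      exact hcv hf
    · have := N.load_reverse_singleton e x' v
      rw [hhe, if_neg hcv, hwe] at this
      rw [if_neg hcv] at hv
      omega
    · intro u hu₂ hule
      obtain ⟨f, h₁, h₂, h₃, h₄, h₅⟩ := hpar u hu₂ (by omega)
      have hfe : Network.reverse {e} x' f = x' f := by
        refine Network.reverse_of_notMem ?_
        rw [Finset.mem_singleton]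
        rintro rfl
        rw [← h₃, hhe] at hule
        omega
      refine ⟨f, h₁, h₂, ?_⟩
      rw [N.head_congr hfe, N.tail_congr hfe]
      exact ⟨h₃, h₄, h₅⟩
    · rwa [hc]
  · refine ⟨x, u, ?_, ?_, hu0, .refl, Network.SameBlue.refl N x, hload, fun _ _ => rfl, ?_,
      fun u hu _ => hT.parent u hu⟩
    · simpa using hx
    · simp [Expr.eval, hu]
    · rw [if_neg huv, add_zero]
  · have h₁ := hT.le_reached u
    have h₂ := reached_le (n := n) (s 10)
    simp only [Expr.eval, Function.update_self, hu, Nat.add_sub_cancel]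
    omega
  · simp only [Expr.cost]
    omega
  · rintro s₁ ⟨⟨x', c, hx', hc, hc0, hreach, hsame, hload, hroot, hv, hpar⟩, heq, hf⟩
    have h10 : s₁ 10 = s 10 := by
      rw [hf 10 (by decide)]
      simp
    simp only [Expr.eval, hc, h10] at heq
    obtain rfl : c = v := hT.eq_root c (by omega)
    rw [if_pos rfl] at hv
    exact ⟨x', hx', hreach, hsame, hv, hroot⟩

/-- On failure `Z` is the set of vertices of the finished search tree, which no red arc leaves and
which has no surplus outside the root. -/
theorem augment_spec (h : N.Holds s) (hx : Encodes (s 7) x) (hfeas : N.Feasible x) {v : Fin n}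
    (hv : s 13 0 = v) :
    Ends Program.augment s (1000 * (n + 2) * (m + 1)) (fun s' =>
      (s' 14 0 ≠ 0 ∧ ∃ x', Encodes (s' 7) x' ∧ N.Reach x x' ∧
        N.SameBlue x' x ∧ N.load x' v = N.load x v + 1 ∧ ∀ f, N.head x f = v → x' f = x f) ∨
      (s' 14 0 = 0 ∧ Encodes (s' 7) x ∧ ∃ Z : Finset (Fin n), v ∈ Z ∧
        (∀ e, N.wt e = 1 → N.tail x e ∈ Z → N.head x e ∈ Z) ∧
        ∀ u ∈ Z, u ≠ v → N.load x u ≤ 2)) := by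
  refine (Ends.seq (T₂ := 300 * (n + 1) * (m + 1) + (100 * (n + 1) + 20))
    (search_spec h hx hv).frame ?_).le ?_
  · rintro s₁ ⟨⟨hT, hcl⟩, hf₁⟩
    have h₁ : N.Holds s₁ := h.congr (hf₁ 0 (by decide)) (hf₁ 1 (by decide)) (hf₁ 6 (by decide))
    have hx₁ : Encodes (s₁ 7) x := by rwa [hf₁ 7 (by decide)]
    refine Ends.seq (findSurplus_spec h₁ hx₁ (by rw [hf₁ 13 (by decide), hv])).frame ?_
    rintro s₂ ⟨hs₂, hf₂⟩
    have h₂ : N.Holds s₂ := h₁.congr (hf₂ 0 (by decide)) (hf₂ 1 (by decide)) (hf₂ 6 (by decide))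
    have hx₂ : Encodes (s₂ 7) x := by rwa [hf₂ 7 (by decide)]
    have h10 := hf₂ 10 (by decide)
    refine (Ends.cond (T₁ := 100 * (n + 1)) (T₂ := 1) ?_ ?_).le ?_
    · intro hne
      rcases hs₂ with ⟨h0, -⟩ | ⟨u, hu, hu0, huv, hload⟩
      · exact absurd h0 hne
      · refine (shift_spec h₂ hx₂ hfeas ?_ hu ?_ huv hload).frame.mono le_rfl ?_
        · rwa [h10, hf₂ 11 (by decide)]
        · rwa [h10]
        · rintro s₃ ⟨h₃, hf₃⟩
          refine .inl ⟨?_, h₃⟩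
          rwa [hf₃ 14 (by decide)]
    · intro heq
      refine Ends.skip ?_
      rcases hs₂ with ⟨h0, hle⟩ | ⟨u, hu, -⟩
      · refine .inr ⟨h0, hx₂, Finset.univ.filter (fun u : Fin n => s₁ 10 u ≠ 0), ?_, ?_, ?_⟩
        · simp [hT.root]
        · simpa using hcl
        · simpa using hle
      · simp only [Expr.eval, hu] at heq
        omega
    · simp only [Expr.cost]
      omega
  · nlinarith

/-- Only red edges move, and `f` itself stays fixed, so its head is `v` throughout. A failed
augmentation occurs while load is still missing at `v`; together with its set `Z` this is a
certificate, for the current `x'` rather than for `x`. -/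
theorem gain_spec (h : N.Holds s) (hx : Encodes (s 7) x) (hfeas : N.Feasible x) {f : Fin m}
    (hf : s 22 0 = f) :
    Ends Program.gain s (4000 * (n + 2) * (m + 1)) (fun s' => ∃ x', Encodes (s' 7) x' ∧
      N.Reach x x' ∧ N.SameBlue x' x ∧
      ((s' 19 0 = 0 ∧ 2 + N.wt f ≤ N.load x' (N.head x' f)) ∨
        (s' 19 0 = 1 ∧ N.Blocked x' (N.head x' f) (N.wt f)))) := by
  set v := N.head x f with hv
  refine (Ends.write_seq (Ends.write_seq (T := 3500 * (n + 2) * (m + 1)) ?_)).le ?_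
  · have h₀ := eval_headOf h hx (e := .var 22) (f := f) (by simp [Expr.eval, hf])
    rw [h₀]
    simp only [Expr.eval, Function.update_self]
    rw [← hv]
    set s₁ := Function.update (Function.update s 13 (Function.update (s 13) 0 (v : ℕ))) 17
      (Function.update (Function.update s 13 (Function.update (s 13) 0 (v : ℕ)) 17) 0 (v : ℕ))
      with hs₁
    have hf₁ : ∀ a, a ≠ 13 → a ≠ 17 → s₁ a = s a := by
      intro a ha ha'
      rw [hs₁, Function.update_of_ne ha', Function.update_of_ne ha]
    have h₁ : N.Holds s₁ := h.congr (hf₁ 0 (by decide) (by decide)) (hf₁ 1 (by decide) (by decide))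
      (hf₁ 6 (by decide) (by decide))
    have hx₁ : Encodes (s₁ 7) x := by rwa [hf₁ 7 (by decide) (by decide)]
    have h13 : s₁ 13 0 = v := by simp [hs₁]
    have h22 : s₁ 22 0 = f := by rw [hf₁ 22 (by decide) (by decide), hf]
    refine (Ends.seq (T₂ := 3200 * (n + 2) * (m + 1)) (computeLoad_spec h₁ hx₁ (u := v)
      (by simp [hs₁])).frame ?_).le (by nlinarith)
    clear_value s₁
    rintro s₂ ⟨h16, hf₂⟩
    have h₂ : N.Holds s₂ := h₁.congr (hf₂ 0 (by decide)) (hf₂ 1 (by decide)) (hf₂ 6 (by decide))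
    have hx₂ : Encodes (s₂ 7) x := by rwa [hf₂ 7 (by decide)]
    replace h13 : s₂ 13 0 = v := by rw [hf₂ 13 (by decide), h13]
    replace h22 : s₂ 22 0 = f := by rw [hf₂ 22 (by decide), h22]
    have hw := h₂.weight f
    -- Two rounds suffice: the load of `v` is at least two by feasibility, and `f` weighs at most
    -- two.
    refine (Ends.write_seq (Ends.write_seq ((Ends.loop (T := 1000 * (n + 2) * (m + 1) + 30) (M := 2)
      (I := fun s' => ∃ x', Encodes (s' 7) x' ∧ N.Reach x x' ∧ N.SameBlue x' x ∧ x' f = x f ∧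
        ((s' 19 0 = 0 ∧ s' 18 0 = 2 + N.wt f - N.load x' v) ∨
          (s' 19 0 = 1 ∧ s' 18 0 = 0 ∧ N.Blocked x' v (N.wt f))))
      (fun s' => s' 18 0) ?_ ?_ ?_).mono (le_refl _) ?_))).le ?_
    · rintro s₃ hf₃ ⟨x', hx', hreach, hsame, hxf, hcase⟩ hne
      simp only [Expr.eval] at hne
      rcases hcase with ⟨h19, h18⟩ | ⟨-, h18, -⟩
      swap
      · exact absurd h18 hne
      have h₃ : N.Holds s₃ := h₂.congr (by rw [hf₃ 0 (by decide)]; simp)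
        (by rw [hf₃ 1 (by decide)]; simp) (by rw [hf₃ 6 (by decide)]; simp)
      have h13₃ : s₃ 13 0 = v := by
        rw [hf₃ 13 (by decide)]
        simp [h13]
      refine (Ends.seq (T₂ := 30) (augment_spec h₃ hx' (hreach.feasible hfeas) h13₃).frame ?_)
      rintro s₄ ⟨hs₄, hf₄⟩
      have h18₄ := hf₄ 18 (by decide)
      have h19₄ := hf₄ 19 (by decide)
      refine (Ends.cond (T₁ := 10) (T₂ := 10) ?_ ?_).le (by decide)
      · intro hne'
        rcases hs₄ with ⟨-, x'', hx'', hr, hsb, hld, hfix⟩ | ⟨h0, -⟩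
        · refine Ends.write ⟨⟨x'', ?_, hreach.trans hr, hsb.trans hsame, ?_, .inl ⟨?_, ?_⟩⟩, ?_⟩
          · simpa using hx''
          · rw [hfix f (by rw [N.head_congr hxf]), hxf]
          · simp [h19₄, h19]
          · simp only [Expr.eval, Function.update_self, h18₄, h18, hld]
            omega
          · simp only [Expr.eval, Function.update_self, h18₄]
            omega
        · exact absurd h0 hne'
      · intro heq'
        rcases hs₄ with ⟨h0, -⟩ | ⟨-, hx'', Z, hZ₁, hZ₂, hZ₃⟩
        · exact absurd heq' h0
        · refine (Ends.write_seq (Ends.write (T := 4) ⟨⟨x', ?_, hreach, hsame, hxf,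
            .inr ⟨?_, ?_, Z, hZ₁, hZ₂, hZ₃, ?_⟩⟩, ?_⟩)).le (by decide)
          · simpa using hx''
          · simp [Expr.eval]
          · simp [Expr.eval]
          · omega
          · simp [Expr.eval]
            omega
    · refine ⟨x, ?_, .refl, Network.SameBlue.refl N x, rfl, .inl ⟨?_, ?_⟩⟩
      · simpa using hx₂
      · simp [Expr.eval]
      · simp [Expr.eval, h22, hw, h16]
    · have := hfeas v
      have := N.wt_eq f
      simp [Expr.eval, h22, hw, h16]
      omega
    · rintro s₃ ⟨⟨x', hx', hreach, hsame, hxf, hcase⟩, heq, -⟩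
      simp only [Expr.eval] at heq
      refine ⟨x', hx', hreach, hsame, ?_⟩
      rw [N.head_congr hxf, ← hv]
      rcases hcase with ⟨h19, h18⟩ | ⟨h19, -, hb⟩
      · exact .inl ⟨h19, by omega⟩
      · exact .inr ⟨h19, hb⟩
    · simp only [Expr.cost]
      nlinarith
  · simp only [Expr.cost]
    nlinarith

/-! ### The list of representatives -/

variable {x₀ : Fin m → Bool} {l l' : List (Fin m → Bool)}

/-- The array `f` holds the list `l` of orientations. -/
def Stored (f : ℕ → ℕ) (l : List (Fin m → Bool)) : Prop :=
  ∀ (j : ℕ) (z : Fin m → Bool), l[j]? = some z → ∀ e : Fin m, f (j * (m + 1) + e) = (z e).toNat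

theorem compare_spec (h : N.Holds s) (hx : Encodes (s 7) x) {z : Fin m → Bool}
    (hz : ∀ e : Fin m, s 8 (s 23 0 + e) = (z e).toNat) (h0 : s 24 0 = 0) :
    Ends (.for 12 Program.numEdges
        (.cond (.and (.minus (.read 1 (.var 12)) (.const 1))
          (.ne (.read 8 (.plus (.var 23) (.var 12))) (.read 7 (.var 12)))) (.assign 24 (.const 1))
            .skip)) s (100 * (m + 1))
      (fun s' => (s' 24 0 = 0 ∧ N.SameBlue z x) ∨ (s' 24 0 = 1 ∧ ¬ N.SameBlue z x)) := by
  refine (Ends.for_ (T := 80) (I := fun k s' =>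
    (s' 24 0 = 0 ∧ ∀ e : Fin m, (e : ℕ) < k → N.wt e = 2 → z e = x e) ∨
      (s' 24 0 = 1 ∧ ¬ N.SameBlue z x)) m (by decide) ?_ ?_ ?_ ?_).mono ?_ ?_
  · intro k s s' hs
    simp [hs]
  · intro s' hs
    rw [Expr.eval, hs 0 (by decide) (by decide)]
    simp [Expr.eval, h.edges]
  · exact .inl ⟨h0, fun e he => absurd he (Nat.not_lt_zero _)⟩
  · intro k s' hk hs' hf hI
    have hw := h.weight ⟨k, hk⟩
    have hxk := hx ⟨k, hk⟩
    have hzk := hz ⟨k, hk⟩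
    have hwt := N.wt_eq ⟨k, hk⟩
    have hb : (Expr.and (.minus (.read 1 (.var 12)) (.const 1)) (.ne (.read 8 (.plus (.var 23)
        (.var 12))) (.read 7 (.var 12)))).eval s' = 0 ↔
        N.wt ⟨k, hk⟩ ≠ 2 ∨ z ⟨k, hk⟩ = x ⟨k, hk⟩ := by
      rw [Expr.eval_and, Expr.eval_ne]
      simp only [Expr.eval, hs', hf 1 (by decide) (by decide), hf 7 (by decide) (by decide),
        hf 8 (by decide) (by decide), hf 23 (by decide) (by decide)]
      simp only at hw hxk hzk
      rw [hw, hxk, hzk]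
      refine or_congr (by omega) ?_
      cases z ⟨k, hk⟩ <;> cases x ⟨k, hk⟩ <;> simp
    refine (Ends.cond (T₁ := 10) (T₂ := 1) ?_ ?_).le (by decide)
    · intro hne
      rw [Ne, hb, not_or, not_not] at hne
      exact Ends.write (.inr ⟨by simp [Expr.eval], fun hsb => hne.2 (hsb _ hne.1)⟩)
    · intro heq
      rw [hb] at heq
      refine Ends.skip (hI.imp ?_ id)
      rintro ⟨h24, hI⟩
      refine ⟨h24, fun e he hwe => ?_⟩
      rcases Nat.lt_succ_iff_lt_or_eq.1 he with he | he
      · exact hI e he hwe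
      · obtain rfl : e = ⟨k, hk⟩ := Fin.ext he
        exact heq.resolve_left (not_not.2 hwe)
  · simp only [Expr.cost]
    omega
  · rintro s' ⟨hs', -⟩
    exact hs'.imp (fun h => ⟨h.1, fun e he => h.2 e e.2 he⟩) id

theorem lookup_spec (h : N.Holds s) (hx : Encodes (s 7) x) (hl : Stored (s 8) l)
    (h21 : s 21 0 = l.length * (m + 1)) (h26 : s 26 0 = m + 1) :
    Ends Program.lookup s (300 * (l.length + 1) * (m + 1) * (m + 1)) (fun s' =>
      (s' 25 0 = 1 ∧ ∃ z ∈ l, N.SameBlue z x) ∨ (s' 25 0 = 0 ∧ ∀ z ∈ l, ¬ N.SameBlue z x)) := by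
  refine (Ends.write_seq (Ends.write_seq ((Ends.loop (T := 100 * (m + 1) + 50)
    -- A coarse count of one cell per round, though each round advances by a whole block; it costs
    -- only a factor `m + 1`.
    (M := l.length * (m + 1))
    (I := fun s' => ∃ j ≤ l.length, s' 23 0 = j * (m + 1) ∧
      ((s' 25 0 = 1 ∧ ∃ z ∈ l, N.SameBlue z x) ∨
        (s' 25 0 = 0 ∧ ∀ i < j, ∀ z, l[i]? = some z → ¬ N.SameBlue z x)))
    (fun s' => l.length * (m + 1) - s' 23 0) ?_ ?_ ?_).mono (le_refl _) ?_))).le ?_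
  · rintro s₁ hf₁ ⟨j, hj, h23, hI⟩ hne
    have hf : ∀ a, a ∉ [12, 23, 24, 25] → s₁ a = s a := by
      intro a ha
      rw [hf₁ a (fun hm => ha ?_), Function.update_of_ne, Function.update_of_ne]
      · rintro rfl
        exact ha (by decide)
      · rintro rfl
        exact ha (by decide)
      · revert hm
        simp [Program.writes, Program.for]
        tauto
    clear hf₁
    simp only [Expr.eval, hf 21 (by decide), h21, h23] at hne
    have hjl : j < l.length := by
      by_contra! hle
      have := Nat.mul_le_mul_right (m + 1) hle
      omega
    have hle : (j + 1) * (m + 1) ≤ l.length * (m + 1) := Nat.mul_le_mul_right _ hjl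
    obtain ⟨z, hz⟩ : ∃ z, l[j]? = some z := ⟨_, List.getElem?_eq_getElem hjl⟩
    have hzl : z ∈ l := List.mem_of_getElem? hz
    refine (Ends.write_seq (Ends.seq (T₂ := 35) (compare_spec (N := N) (x := x) (z := z)
      ?_ ?_ ?_ ?_).frame ?_)).le ?_
    · exact h.congr (by simp [hf]) (by simp [hf]) (by simp [hf])
    · simpa [hf] using hx
    · simpa [hf, h23] using hl j z hz
    · simp [Expr.eval]
    · rintro s₂ ⟨hs₂, hf₂⟩
      replace hf₂ : ∀ a, a ∉ [12, 24] → s₂ a = s₁ a := by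
        intro a ha
        rw [hf₂ a (fun hm => ha ?_), Function.update_of_ne]
        · rintro rfl
          exact ha (by decide)
        · revert hm
          simp [Program.writes, Program.for]
          tauto
      refine (Ends.seq (T₁ := 15) (T₂ := 10) (R := fun s₃ => (∀ a, a ∉ [12, 24, 25] → s₃ a = s₁ a) ∧
        ((s₃ 25 0 = 1 ∧ ∃ z ∈ l, N.SameBlue z x) ∨
          (s₃ 25 0 = 0 ∧ ∀ i < j + 1, ∀ z, l[i]? = some z → ¬ N.SameBlue z x))) ?_ ?_).le (by decide)
      · refine (Ends.cond (T₁ := 1) (T₂ := 4) ?_ ?_).le (by decide)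
        · intro hne'
          refine Ends.skip ⟨fun a ha => hf₂ a (by simp at ha ⊢; tauto), ?_⟩
          rcases hs₂ with ⟨h0, -⟩ | ⟨-, hnot⟩
          · exact absurd h0 hne'
          · rw [hf₂ 25 (by decide)]
            refine hI.imp id ?_
            rintro ⟨h25, hI⟩
            refine ⟨h25, fun i hi z' hz' => ?_⟩
            rcases Nat.lt_succ_iff_lt_or_eq.1 hi with hi | rfl
            · exact hI i hi z' hz'
            · rw [hz] at hz'
              cases hz'
              exact hnot
        · intro heq'
          refine Ends.write ⟨?_, ?_⟩
          · intro a ha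
            rw [Function.update_of_ne (by rintro rfl; exact ha (by decide))]
            exact hf₂ a (by simp at ha ⊢; tauto)
          · rcases hs₂ with ⟨-, hsb⟩ | ⟨h1, -⟩
            · exact .inl ⟨by simp [Expr.eval], z, hzl, hsb⟩
            · simp [Expr.eval, h1] at heq'
      · rintro s₃ ⟨hf₃, hs₃⟩
        have h23' : s₃ 23 0 = j * (m + 1) := by rw [hf₃ 23 (by decide), h23]
        have h26' : s₃ 26 0 = m + 1 := by rw [hf₃ 26 (by decide), hf 26 (by decide), h26]
        refine Ends.write ⟨⟨j + 1, hjl, ?_, ?_⟩, ?_⟩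
        · simp only [Expr.eval, Function.update_self, h23', h26']
          ring
        · simpa using hs₃
        · simp only [Expr.eval, Function.update_self, h23', h26', h23]
          have : (j + 1) * (m + 1) = j * (m + 1) + (m + 1) := by ring
          omega
    · simp only [Expr.cost]
      omega
  · refine ⟨0, Nat.zero_le _, ?_, .inr ⟨?_, fun i hi => absurd hi (Nat.not_lt_zero _)⟩⟩
    · simp [Expr.eval]
    · simp [Expr.eval]
  · simp
  · rintro s' ⟨⟨j, hj, h23, hI⟩, heq, hf⟩
    refine hI.imp id ?_
    rintro ⟨h25, hI⟩
    refine ⟨h25, fun z hz => ?_⟩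
    have h21' : s' 21 0 = l.length * (m + 1) := by
      rw [hf 21 (by decide)]
      simp [h21]
    simp only [Expr.eval, h21', h23] at heq
    have hjl : j = l.length := by
      by_contra hne
      have : (j + 1) * (m + 1) ≤ l.length * (m + 1) := Nat.mul_le_mul_right _ (by omega)
      have h2 : (j + 1) * (m + 1) = j * (m + 1) + (m + 1) := by ring
      omega
    obtain ⟨i, hi⟩ := List.getElem?_of_mem hz
    refine hI i ?_ z hi
    rw [hjl]
    by_contra! hle
    rw [List.getElem?_eq_none hle] at hi
    cases hi
  · simp only [Expr.cost]
    have : (l.length * (m + 1)) * (m + 1) ≤ (l.length * (m + 1)) * (m + 1) := le_rfl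
    nlinarith [Nat.zero_le (l.length * (m + 1)), Nat.zero_le (l.length * (m + 1) * m),
      Nat.zero_le (m * m), Nat.zero_le (l.length * m)]

theorem append_spec (h : N.Holds s) (hx : Encodes (s 7) x) (hl : Stored (s 8) l)
    (h21 : s 21 0 = l.length * (m + 1)) (h26 : s 26 0 = m + 1) :
    Ends Program.append s (50 * (m + 1)) (fun s' => Stored (s' 8) (l ++ [x]) ∧
      s' 21 0 = (l ++ [x]).length * (m + 1)) := by
  refine (Ends.seq (T₂ := 10) (Ends.for_ (T := 20) (I := fun k s' => Stored (s' 8) l ∧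
    ∀ e : Fin m, (e : ℕ) < k → s' 8 (l.length * (m + 1) + e) = (x e).toNat) m (by decide)
    ?_ ?_ ?_ ?_) ?_).le ?_
  · intro k s s' hs
    simp [hs]
  · intro s' hs
    rw [Expr.eval, hs 0 (by decide) (by decide)]
    simp [Expr.eval, h.edges]
  · exact ⟨hl, fun e he => absurd he (Nat.not_lt_zero _)⟩
  · rintro k s' hk hs' hf ⟨hI₁, hI₂⟩
    have h21' : s' 21 0 = l.length * (m + 1) := by rw [hf 21 (by decide) (by decide), h21]
    have hxk := hx ⟨k, hk⟩
    refine Ends.write ?_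
    simp only [Expr.eval, Function.update_self, h21', hs', hf 7 (by decide) (by decide)]
    constructor
    · intro j z hz e
      -- The cell written lies beyond the end of every block already stored.
      rw [Function.update_of_ne, hI₁ j z hz e]
      have hj : j < l.length := by
        by_contra! hle
        rw [List.getElem?_eq_none hle] at hz
        cases hz
      have h2 : (j + 1) * (m + 1) ≤ l.length * (m + 1) := Nat.mul_le_mul_right _ hj
      have h3 : (j + 1) * (m + 1) = j * (m + 1) + (m + 1) := by ring
      omega
    · intro e he
      by_cases hek : (e : ℕ) = k
      · subst hek
        rw [Function.update_self]
        exact hxk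
      · rw [Function.update_of_ne (by omega)]
        exact hI₂ e (by omega)
  · rintro s₁ ⟨⟨h₁, h₂⟩, hf⟩
    refine Ends.write ⟨?_, ?_⟩
    · simp only [ne_eq, Nat.reduceEqDiff, not_false_eq_true, Function.update_of_ne]
      intro j z hz e
      rcases lt_trichotomy j l.length with hj | rfl | hj
      · rw [List.getElem?_append_left hj] at hz
        exact h₁ j z hz e
      · rw [List.getElem?_concat_length] at hz
        cases hz
        exact h₂ e e.2
      · rw [List.getElem?_eq_none (by simp; omega)] at hz
        cases hz
    · simp only [Expr.eval, Function.update_self, hf 21 (by decide) (by decide), h21,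
        hf 26 (by decide) (by decide), h26, List.length_append, List.length_singleton]
      ring
  · simp only [Expr.cost]
    omega

theorem Network.SameBlue.reverse {x y : Fin m → Bool} (h : N.SameBlue x y) (S : Finset (Fin m)) :
    N.SameBlue (Network.reverse S x) (Network.reverse S y) := by
  intro e he
  simp only [Network.reverse_apply, h e he]

/-- The memory holds a list `l` of orientations that can be reached from `x₀` and pairwise differ on
the blue edges, and only edges are marked that can be reversed. -/
structure Explored (N : Network (Fin n) (Fin m)) (x₀ : Fin m → Bool) (s : State)
    (l : List (Fin m → Bool)) : Prop where
  holds : N.Holds s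
  stored : Stored (s 8) l
  length : s 21 0 = l.length * (m + 1)
  block : s 26 0 = m + 1
  mem : x₀ ∈ l
  reach : ∀ x ∈ l, N.Reach x₀ x
  pairwise : l.Pairwise fun x y => ¬ N.SameBlue x y
  marked : ∀ e : Fin m, s 9 e ≠ 0 → ∃ z, N.Reach x₀ z ∧ z e ≠ x₀ e

theorem Explored.congr {s' : State} (h : Explored N x₀ s l)
    (hs : ∀ a ∈ [0, 1, 6, 8, 9, 21, 26], s' a = s a) : Explored N x₀ s' l := by
  refine ⟨h.holds.congr (hs 0 (by decide)) (hs 1 (by decide)) (hs 6 (by decide)), ?_, ?_, ?_, h.mem,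
    h.reach, h.pairwise, ?_⟩
  · rw [hs 8 (by decide)]
    exact h.stored
  · rw [hs 21 (by decide)]
    exact h.length
  · rw [hs 26 (by decide)]
    exact h.block
  · rw [hs 9 (by decide)]
    exact h.marked

theorem Explored.length_le (h : Explored N x₀ s l) :
    l.length ≤ 2 ^ (Finset.univ.filter (fun e => N.wt e = 2)).card :=
  Network.length_le_of_pairwise h.pairwise

/-- The reversal of `e` has been tried from the orientation `x`. -/
def Tried (N : Network (Fin n) (Fin m)) (f : ℕ → ℕ) (l : List (Fin m → Bool)) (x : Fin m → Bool)
    (e : Fin m) : Prop :=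
  (f e ≠ 0 ∧ ∃ z ∈ l, N.SameBlue z (Network.reverse {e} x)) ∨
    ∃ x', N.SameBlue x' x ∧ N.Blocked x' (N.head x' e) (N.wt e)

theorem Tried.mono {f g : ℕ → ℕ} {e : Fin m} (h : Tried N f l x e)
    (hfg : ∀ e : Fin m, f e ≠ 0 → g e ≠ 0) (hl : l <+: l') : Tried N g l' x e := by
  refine h.imp ?_ id
  rintro ⟨h₁, z, hz, hsb⟩
  exact ⟨hfg e h₁, z, hl.subset hz, hsb⟩

/-- Either `gain` leaves a certificate, or `f` is reversed in some `x'` with the blue part of `x`.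
The result has the blue part of `x` with `f` reversed, so an entry found by the lookup serves as
well as a new one. -/
theorem tryEdge_spec (hx₀ : N.Feasible x₀) (h : Explored N x₀ s l) {i : ℕ} (hi : l[i]? = some x)
    (h20 : s 20 0 = i * (m + 1)) {f : Fin m} (hf : s 22 0 = f) {K : ℕ} (hK : l.length ≤ K) :
    Ends Program.tryEdge s (5000 * (K + 1) * (n + 2) * (m + 1) * (m + 1)) (fun s' => ∃ l',
      Explored N x₀ s' l' ∧ l <+: l' ∧ (∀ e : Fin m, s 9 e ≠ 0 → s' 9 e ≠ 0) ∧
      Tried N (s' 9) l' x f) := by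
  have hxl : x ∈ l := List.mem_of_getElem? hi
  have hreach := h.reach x hxl
  have hfeas := hreach.feasible hx₀
  have hB := Nat.mul_le_mul_right ((m + 1) * (m + 1)) (Nat.mul_le_mul_left 300
    (Nat.add_le_add_right hK 1))
  refine (Ends.seq (T₂ := 4000 * (n + 2) * (m + 1) + (300 * (K + 1) * (m + 1) * (m + 1) +
    (50 * (m + 1) + 100))) (copy_spec (x := x) h.holds ?_).frame ?_).le ?_
  · rw [h20]
    exact h.stored i x hi
  · rintro s₁ ⟨hx₁, hf₁⟩
    have h₁ : Explored N x₀ s₁ l := h.congr fun a ha => hf₁ a (by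
      revert a
      decide)
    have h22 : s₁ 22 0 = f := by rw [hf₁ 22 (by decide), hf]
    refine Ends.seq (gain_spec h₁.holds hx₁ hfeas h22).frame ?_
    rintro s₂ ⟨⟨x', hx₂, hr, hsb, hcase⟩, hf₂⟩
    have h₂ : Explored N x₀ s₂ l := h₁.congr fun a ha => hf₂ a (by
      revert a
      decide)
    have h9 : s₂ 9 = s 9 := by rw [hf₂ 9 (by decide), hf₁ 9 (by decide)]
    replace h22 : s₂ 22 0 = f := by rw [hf₂ 22 (by decide), h22]
    refine (Ends.cond (T₁ := 1) (T₂ := 300 * (K + 1) * (m + 1) * (m + 1) + (50 * (m + 1) + 70))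
      ?_ ?_).le ?_
    · intro hne
      refine Ends.skip ⟨l, h₂, List.prefix_rfl, by rw [h9]; exact fun _ h => h, .inr ⟨x', hsb, ?_⟩⟩
      rcases hcase with ⟨h0, -⟩ | ⟨-, hb⟩
      · exact absurd h0 hne
      · exact hb
    · intro heq
      have hsur : 2 + N.wt f ≤ N.load x' (N.head x' f) := by
        rcases hcase with ⟨-, h⟩ | ⟨h1, -⟩
        · exact h
        · simp [Expr.eval, h1] at heq
      have hr' : N.Reach x₀ (Network.reverse {f} x') :=
        (hreach.trans hr).tail ⟨f, hsur, rfl⟩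
      refine (Ends.write_seq (Ends.write_seq
        (T := 300 * (K + 1) * (m + 1) * (m + 1) + (50 * (m + 1) + 20)) ?_)).le ?_
      · have he₁ : (Expr.var 22).eval s₂ = f := h22
        have he₂ : ∀ g, (Expr.var 22).eval (Function.update s₂ 7 g) = f := by
          intro g
          simpa [Expr.eval] using h22
        rw [he₂, he₁]
        simp only [Expr.eval, h22]
        set s₃ := Function.update (Function.update s₂ 7 (Function.update (s₂ 7) f
          (1 - s₂ 7 f))) 9 (Function.update (Function.update s₂ 7 (Function.update (s₂ 7) f
          (1 - s₂ 7 f)) 9) f 1) with hs₃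
        have hf₃ : ∀ a, a ≠ 7 → a ≠ 9 → s₃ a = s₂ a := by
          intro a ha ha'
          rw [hs₃, Function.update_of_ne ha', Function.update_of_ne ha]
        have h7 : Encodes (s₃ 7) (Network.reverse {f} x') := by
          refine encodes_flip hx₂ f ?_
          simp [hs₃]
        have h9₃ : s₃ 9 = Function.update (s 9) f 1 := by
          simp [hs₃, h9]
        clear_value s₃
        have h9mono : ∀ e : Fin m, s 9 e ≠ 0 → s₃ 9 e ≠ 0 := by
          intro e he
          rw [h9₃]
          by_cases hef : (e : ℕ) = f
          · rw [hef, Function.update_self]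
            omega
          · rwa [Function.update_of_ne hef]
        have hmark : ∀ e : Fin m, s₃ 9 e ≠ 0 → ∃ z, N.Reach x₀ z ∧ z e ≠ x₀ e := by
          intro e he
          rw [h9₃] at he
          by_cases hef : e = f
          · subst hef
            by_cases hz : x' e = x₀ e
            · refine ⟨_, hr', ?_⟩
              rw [Network.reverse_of_mem (Finset.mem_singleton_self e), hz]
              simp
            · exact ⟨x', hreach.trans hr, hz⟩
          · rw [Function.update_of_ne (Fin.val_ne_of_ne hef)] at he
            exact h.marked e he
        have h₃ : Explored N x₀ s₃ l := by
          refine ⟨h₂.holds.congr (hf₃ 0 (by decide) (by decide)) (hf₃ 1 (by decide) (by decide))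
            (hf₃ 6 (by decide) (by decide)), ?_, ?_, ?_, h.mem, h.reach, h.pairwise, hmark⟩
          · rw [hf₃ 8 (by decide) (by decide)]
            exact h₂.stored
          · rw [hf₃ 21 (by decide) (by decide)]
            exact h₂.length
          · rw [hf₃ 26 (by decide) (by decide)]
            exact h₂.block
        have hblue : N.SameBlue (Network.reverse {f} x') (Network.reverse {f} x) := hsb.reverse _
        refine (Ends.seq (T₂ := 50 * (m + 1) + 20)
          (lookup_spec h₃.holds h7 h₃.stored h₃.length h₃.block).frame ?_).le (by nlinarith)
        rintro s₄ ⟨hs₄, hf₄⟩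
        have h₄ : Explored N x₀ s₄ l := h₃.congr fun a ha => hf₄ a (by
          revert a
          decide)
        have h9₄ := hf₄ 9 (by decide)
        have h9f : s₃ 9 f ≠ 0 := by
          rw [h9₃, Function.update_self]
          omega
        refine (Ends.cond (T₁ := 1) (T₂ := 50 * (m + 1)) ?_ ?_).le ?_
        · intro hne
          rcases hs₄ with ⟨-, z, hz, hzb⟩ | ⟨h0, -⟩
          · refine Ends.skip ⟨l, h₄, List.prefix_rfl, by rwa [h9₄], .inl ⟨by rwa [h9₄], z, hz,
              hzb.trans hblue⟩⟩
          · exact absurd h0 hne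
        · intro heq'
          rcases hs₄ with ⟨h1, -⟩ | ⟨-, hnot⟩
          · simp [Expr.eval, h1] at heq'
          · refine (append_spec (x := Network.reverse {f} x') h₄.holds ?_ h₄.stored h₄.length
              h₄.block).frame.mono le_rfl ?_
            · rwa [hf₄ 7 (by decide)]
            · rintro s₅ ⟨⟨hst, hlen⟩, hf₅⟩
              have h9₅ := hf₅ 9 (by decide)
              refine ⟨l ++ [Network.reverse {f} x'], ⟨h₄.holds.congr (hf₅ 0 (by decide))
                (hf₅ 1 (by decide)) (hf₅ 6 (by decide)), hst, hlen, ?_, ?_, ?_, ?_, ?_⟩,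
                List.prefix_append _ _, by rwa [h9₅, h9₄], .inl ⟨by rwa [h9₅, h9₄],
                Network.reverse {f} x', by simp, hblue⟩⟩
              · rw [hf₅ 26 (by decide)]
                exact h₄.block
              · exact List.mem_append_left _ h.mem
              · intro z hz
                rcases List.mem_append.1 hz with hz | hz
                · exact h.reach z hz
                · rw [List.mem_singleton.1 hz]
                  exact hr'
              · rw [List.pairwise_append]
                refine ⟨h.pairwise, List.pairwise_singleton _ _, fun a ha b hb => ?_⟩
                rw [List.mem_singleton.1 hb]
                exact hnot a ha
              · rw [h9₅, h9₄]
                exact hmark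
        · simp only [Expr.cost]
          omega
      · simp only [Expr.cost]
        omega
    · simp only [Expr.cost]
      omega
  · have h₁ : 1 ≤ (m + 1) := by omega
    have h₂ : 1 ≤ K + 1 := by omega
    have h₃ : 2 ≤ n + 2 := by omega
    generalize m + 1 = a at *
    generalize K + 1 = b at *
    generalize n + 2 = c at *
    have e₁ : a ≤ b * c * a * a := by
      calc a = 1 * 1 * a * 1 := by ring
        _ ≤ b * c * a * a := by gcongr; omega
    have e₂ : c * a ≤ b * c * a * a := by
      calc c * a = 1 * c * a * 1 := by ring
        _ ≤ b * c * a * a := by gcongr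
    have e₃ : b * a * a ≤ b * c * a * a := by
      calc b * a * a = b * 1 * a * a := by ring
        _ ≤ b * c * a * a := by gcongr; omega
    nlinarith

/-- The list grows while it is scanned. It is only ever extended and marks are never erased, so
tries already made remain valid (`Tried.mono`); at the end every entry has been processed and the
list is saturated. -/
theorem explore_spec (hx₀ : N.Feasible x₀) (h : Explored N x₀ s l) (h20 : s 20 0 = 0) {K : ℕ}
    (hK : K = 2 ^ (Finset.univ.filter (fun e => N.wt e = 2)).card) :
    Ends Program.explore s
      (K * (m + 1) * (m * (5000 * (K + 1) * (n + 2) * (m + 1) * (m + 1) + 13) + 50) + 6)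
      (fun s' => ∃ l', Explored N x₀ s' l' ∧ ∀ z ∈ l', ∀ e, Tried N (s' 9) l' z e) := by
  refine (Ends.loop (T := m * (5000 * (K + 1) * (n + 2) * (m + 1) * (m + 1) + 13) + 40)
    (M := K * (m + 1))
    (I := fun s' => ∃ (l : List (Fin m → Bool)) (i : ℕ), Explored N x₀ s' l ∧
      s' 20 0 = i * (m + 1) ∧ i ≤ l.length ∧
      ∀ j < i, ∀ z, l[j]? = some z → ∀ e, Tried N (s' 9) l z e)
    -- The potential refers to the bound `K` on the length of any such list, since the current
    -- length is not fixed.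
    (fun s' => K * (m + 1) - s' 20 0) ?_ ?_ ?_).mono ?_ ?_
  · rintro s₁ - ⟨l, i, h₁, h20, hil, htried⟩ hne
    simp only [Expr.eval, h₁.length, h20] at hne
    have hil : i < l.length := by
      by_contra! hle
      have := Nat.mul_le_mul_right (m + 1) hle
      omega
    obtain ⟨x, hx⟩ : ∃ x, l[i]? = some x := ⟨_, List.getElem?_eq_getElem hil⟩
    refine (Ends.seq (T₂ := 10)
      (Ends.for_ (T := 5000 * (K + 1) * (n + 2) * (m + 1) * (m + 1))
        (I := fun k s' => ∃ l', Explored N x₀ s' l' ∧ l <+: l' ∧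
          (∀ e : Fin m, s₁ 9 e ≠ 0 → s' 9 e ≠ 0) ∧
          ∀ e : Fin m, (e : ℕ) < k → Tried N (s' 9) l' x e) m (by decide) ?_ ?_ ?_ ?_) ?_).le ?_
    · rintro k s s' hs ⟨l', h₁, h₂, h₃, h₄⟩
      have h9 := hs 9 (by decide)
      refine ⟨l', h₁.congr fun a ha => hs a (by revert a; decide), h₂, by rwa [h9], by rwa [h9]⟩
    · intro s' hs
      rw [Expr.eval, hs 0 (by decide) (by decide)]
      exact h₁.holds.edges
    · exact ⟨l, h₁, List.prefix_rfl, fun _ h => h, fun e he => absurd he (Nat.not_lt_zero _)⟩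
    · rintro k s₂ hk h22 hf₂ ⟨l', h₂, hpre, h9, htr⟩
      have hx' : l'[i]? = some x := by
        obtain ⟨t, rfl⟩ := hpre
        rw [List.getElem?_append_left hil, hx]
      refine (tryEdge_spec hx₀ h₂ hx' (f := ⟨k, hk⟩) ?_ h22 (hK ▸ h₂.length_le)).mono le_rfl ?_
      · rw [hf₂ 20 (by decide) (by decide), h20]
      · rintro s₃ ⟨l'', h₃, hpre', h9', htr'⟩
        refine ⟨l'', h₃, hpre.trans hpre', fun e he => h9' e (h9 e he), fun e he => ?_⟩
        rcases Nat.lt_succ_iff_lt_or_eq.1 he with he | he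
        · exact (htr e he).mono h9' hpre'
        · obtain rfl : e = ⟨k, hk⟩ := Fin.ext he
          exact htr'
    · rintro s₂ ⟨⟨l', h₂, hpre, h9, htr⟩, hf₂⟩
      have h20' : s₂ 20 0 = i * (m + 1) := by rw [hf₂ 20 (by decide) (by decide), h20]
      have hsucc : (i + 1) * (m + 1) = i * (m + 1) + (m + 1) := by ring
      have hlen : (i + 1) ≤ K := hK ▸ (Nat.succ_le_of_lt hil).trans h₁.length_le
      have hlen' := Nat.mul_le_mul_right (m + 1) hlen
      refine Ends.write ⟨⟨l', i + 1, h₂.congr ?_, ?_, ?_, ?_⟩, ?_⟩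
      · intro a ha
        rw [Function.update_of_ne]
        rintro rfl
        revert ha
        decide
      · simp only [Expr.eval, Function.update_self, h20', h₂.block]
        exact hsucc.symm
      · exact (Nat.succ_le_of_lt hil).trans hpre.length_le
      · simp only [ne_eq, Nat.reduceEqDiff, not_false_eq_true, Function.update_of_ne]
        intro j hj z hz e
        rcases Nat.lt_succ_iff_lt_or_eq.1 hj with hj | rfl
        · obtain ⟨t, rfl⟩ := hpre
          rw [List.getElem?_append_left (by omega)] at hz
          exact (htried j hj z hz e).mono h9 (List.prefix_append _ _)
        · obtain ⟨t, rfl⟩ := hpre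
          rw [List.getElem?_append_left hil, hx] at hz
          cases hz
          exact htr e e.2
      · simp only [Expr.eval, Function.update_self, h20', h₂.block, h20]
        omega
    · simp only [Expr.cost]
      generalize 5000 * (K + 1) * (n + 2) * (m + 1) * (m + 1) = A
      nlinarith
  · exact ⟨l, 0, h, by simp [h20], Nat.zero_le _, fun j hj => absurd hj (Nat.not_lt_zero _)⟩
  · simp
  · simp only [Expr.cost]
    nlinarith
  · rintro s₁ ⟨⟨l, i, h₁, h20, hil, htried⟩, heq, -⟩
    simp only [Expr.eval, h₁.length, h20] at heq
    have hil' : i = l.length := by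
      by_contra hne
      have h1 : (i + 1) * (m + 1) ≤ l.length * (m + 1) := Nat.mul_le_mul_right _ (by omega)
      have h2 : (i + 1) * (m + 1) = i * (m + 1) + (m + 1) := by ring
      omega
    refine ⟨l, h₁, fun z hz => ?_⟩
    obtain ⟨j, hj⟩ := List.getElem?_of_mem hz
    refine htried j ?_ z hj
    by_contra! hle
    rw [List.getElem?_eq_none (hil' ▸ hle)] at hj
    cases hj

/-- This evaluates the criterion of `reach_iff_of_saturated`: the lookup tests the blue part of the
target, and the scan tests that every reversed edge is marked. -/
theorem decideTarget_spec (hx₀ : N.Feasible fun _ => false)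
    (h : Explored N (fun _ => false) s l) (htried : ∀ z ∈ l, ∀ e, Tried N (s 9) l z e)
    {y : Fin m → Bool} (hy : N.Feasible y) (hs : ∀ e : Fin m, s 5 e = s 3 e ↔ y e = false) {K : ℕ}
    (hK : l.length ≤ K) :
    Ends Program.decideTarget s (500 * (K + 1) * (m + 1) * (m + 1)) (fun s' =>
      (N.Reach (fun _ => false) y → output s' = 1) ∧
        (¬ N.Reach (fun _ => false) y → output s' = 0)) := by
  have hB := Nat.mul_le_mul_right ((m + 1) * (m + 1)) (Nat.mul_le_mul_left 300
    (Nat.add_le_add_right hK 1))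
  have hiff := N.reach_iff_of_saturated hx₀ (L := {z | z ∈ l}) (F := fun e => s 9 e ≠ 0) h.mem
    h.reach h.marked (fun z hz e => htried z hz e) hy
  have hload : Ends (.for 12 Program.numEdges (.cond (.ne (.read 5 (.var 12)) (.read 3 (.var 12)))
      (.write 7 (.var 12) (.const 1)) (.write 7 (.var 12) (.const 0)))) s (60 * (m + 1))
      (fun s' => Encodes (s' 7) y) := by
    refine (Ends.for_ (T := 40) (I := fun k s' => ∀ e : Fin m, (e : ℕ) < k →
      s' 7 e = (y e).toNat) m (by decide) ?_ ?_ ?_ ?_).mono ?_ ?_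
    · intro k s s' hs
      simp [hs]
    · intro s' hs
      rw [Expr.eval, hs 0 (by decide) (by decide)]
      exact h.holds.edges
    · exact fun e he => absurd he (Nat.not_lt_zero _)
    · intro k s' hk hs' hf hI
      have hb : (Expr.ne (.read 5 (.var 12)) (.read 3 (.var 12))).eval s' = 0 ↔
          y ⟨k, hk⟩ = false := by
        rw [Expr.eval_ne]
        simp only [Expr.eval, hs', hf 5 (by decide) (by decide), hf 3 (by decide) (by decide)]
        exact hs ⟨k, hk⟩
      refine (Ends.cond (T₁ := 10) (T₂ := 10) ?_ ?_).le (by decide)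
      · intro hne
        rw [Ne, hb] at hne
        refine Ends.write fun e he => ?_
        simp only [Expr.eval, Function.update_self, hs']
        by_cases hek : (e : ℕ) = k
        · obtain rfl : e = ⟨k, hk⟩ := Fin.ext hek
          simp [hne]
        · rw [Function.update_of_ne hek]
          exact hI e (by omega)
      · intro heq
        rw [hb] at heq
        refine Ends.write fun e he => ?_
        simp only [Expr.eval, Function.update_self, hs']
        by_cases hek : (e : ℕ) = k
        · obtain rfl : e = ⟨k, hk⟩ := Fin.ext hek
          simp [heq]
        · rw [Function.update_of_ne hek]
          exact hI e (by omega)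
    · simp only [Expr.cost]
      omega
    · rintro s' ⟨hs', -⟩ e
      exact hs' e e.2
  refine (Ends.seq (T₂ := 300 * (K + 1) * (m + 1) * (m + 1) + (80 * (m + 1) + 10))
    hload.frame ?_).le ?_
  · rintro s₁ ⟨hx₁, hf₁⟩
    have h₁ : Explored N (fun _ => false) s₁ l := h.congr fun a ha => hf₁ a (by
      revert a
      decide)
    refine (Ends.seq (T₂ := 80 * (m + 1) + 10)
      (lookup_spec h₁.holds hx₁ h₁.stored h₁.length h₁.block).frame ?_).le (by nlinarith)
    rintro s₂ ⟨hs₂, hf₂⟩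
    have h9 : s₂ 9 = s 9 := by rw [hf₂ 9 (by decide), hf₁ 9 (by decide)]
    have hx₂ : Encodes (s₂ 7) y := by rwa [hf₂ 7 (by decide)]
    have h0 : s₂ 0 = s 0 := by rw [hf₂ 0 (by decide), hf₁ 0 (by decide)]
    refine (Ends.seq (T₂ := 10) (Ends.for_ (T := 40)
      (I := fun k s' => s' 25 0 ≤ 1 ∧ (s' 25 0 = 1 ↔ (∃ z ∈ l, N.SameBlue z y) ∧
        ∀ e : Fin m, (e : ℕ) < k → y e ≠ false → s 9 e ≠ 0)) m (by decide) ?_ ?_ ?_ ?_) ?_).le ?_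
    · intro k s s' hs
      simp [hs]
    · intro s' hs
      rw [Expr.eval, hs 0 (by decide) (by decide), h0]
      exact h.holds.edges
    · rcases hs₂ with ⟨h1, hex⟩ | ⟨h1, hno⟩
      · exact ⟨h1.le, fun _ => ⟨hex, fun e he => absurd he (Nat.not_lt_zero _)⟩, fun _ => h1⟩
      · refine ⟨by omega, by omega, ?_⟩
        rintro ⟨⟨z, hz, hzb⟩, -⟩
        exact absurd hzb (hno z hz)
    · rintro k s' hk hs' hf ⟨hle, hI⟩
      have hxk := hx₂ ⟨k, hk⟩
      have hb : (Expr.and (.read 7 (.var 12)) (.minus (.const 1) (.read 9 (.var 12)))).eval s' = 0 ↔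
          (y ⟨k, hk⟩ ≠ false → s 9 k ≠ 0) := by
        rw [Expr.eval_and]
        simp only [Expr.eval, hs', hf 7 (by decide) (by decide), hf 9 (by decide) (by decide), h9]
        simp only at hxk
        rw [hxk]
        cases y ⟨k, hk⟩ <;> simp
        omega
      refine (Ends.cond (T₁ := 10) (T₂ := 1) ?_ ?_).le (by decide)
      · intro hne
        rw [Ne, hb] at hne
        refine Ends.write ⟨by simp [Expr.eval], ?_⟩
        simp only [Expr.eval, Function.update_self]
        refine ⟨fun h => by omega, fun h => absurd (h.2 ⟨k, hk⟩ (Nat.lt_succ_self k)) hne⟩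
      · intro heq
        rw [hb] at heq
        refine Ends.skip ⟨hle, hI.trans (and_congr_right fun _ => ⟨fun h e he => ?_,
          fun h e he => h e (Nat.lt_succ_of_lt he)⟩)⟩
        rcases Nat.lt_succ_iff_lt_or_eq.1 he with he | he
        · exact h e he
        · obtain rfl : e = ⟨k, hk⟩ := Fin.ext he
          exact heq
    · rintro s₃ ⟨⟨hle, hI⟩, -⟩
      refine Ends.write ?_
      have hout : ∀ f, output (Function.update s₃ 0 f) = f 0 := fun f => by simp [output]
      have hreach : s₃ 25 0 = 1 ↔ N.Reach (fun _ => false) y := by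
        rw [hI, hiff]
        exact and_congr_right fun _ => ⟨fun h e => h e e.2, fun h e _ => h e⟩
      rw [hout]
      simp only [Expr.eval, Function.update_self]
      refine ⟨hreach.2, fun hn => ?_⟩
      have : s₃ 25 0 ≠ 1 := fun h => hn (hreach.1 h)
      omega
    · simp only [Expr.cost]
      omega
  · have : m + 1 ≤ (K + 1) * (m + 1) * (m + 1) := by
      calc m + 1 = 1 * (m + 1) * 1 := by ring
        _ ≤ (K + 1) * (m + 1) * (m + 1) := by gcongr <;> omega
    nlinarith

/-! ## Orientations of constraint graphs -/

/-- The network of a constraint graph, with an orientation of it as the reference. -/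
def ConstraintGraph.network {V E : Type*} (G : ConstraintGraph V E) (A : G.Orientation) :
    Network V E where
  hd e := (A.arc e).2
  tl e := (A.arc e).1
  wt := G.weight
  wt_eq := G.weight_eq

namespace ConstraintGraph.Orientation

variable {V E : Type*} {G : ConstraintGraph V E}

/-- The orientation that differs from `A` in the direction of the edges `e` with `x e = true`. -/
def decode (A : G.Orientation) (x : E → Bool) : G.Orientation where
  arc e := if x e then (A.arc e).swap else A.arc e
  arc_ends e := by
    cases x e
    · simpa using A.arc_ends e
    · simp only [if_true, Prod.fst_swap, Prod.snd_swap]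
      rw [Sym2.eq_swap]
      exact A.arc_ends e

/-- The edges whose heads in `A` and `B` differ. -/
def encode [DecidableEq V] (A B : G.Orientation) (e : E) : Bool :=
  !decide ((B.arc e).2 = (A.arc e).2)

theorem arc_eq_or_eq_swap (A B : G.Orientation) (e : E) :
    B.arc e = A.arc e ∨ B.arc e = (A.arc e).swap := by
  have h := (B.arc_ends e).trans (A.arc_ends e).symm
  rw [Sym2.eq_iff] at h
  rcases h with h | h
  · exact .inl (Prod.ext h.1 h.2)
  · exact .inr (Prod.ext h.1 h.2)

theorem decode_encode [DecidableEq V] (A B : G.Orientation) : A.decode (A.encode B) = B := by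
  ext e : 2
  simp only [decode, encode]
  rcases A.arc_eq_or_eq_swap B e with h | h
  · simp [h]
  -- A loop is always encoded as not reversed, which is harmless because its arc is its own swap.
  · by_cases hh : (A.arc e).1 = (A.arc e).2
    · simp only [h, Prod.snd_swap, hh, decide_true, Bool.not_true]
      exact (Prod.ext hh hh.symm)
    · simp [h, hh]

theorem head_decode (A : G.Orientation) (x : E → Bool) (e : E) :
    ((A.decode x).arc e).2 = (G.network A).head x e := by
  simp only [decode, Network.head, ConstraintGraph.network]
  cases x e <;> simp

theorem decode_reverse [DecidableEq E] (A : G.Orientation) (x : E → Bool) (e : E) :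
    A.decode (Network.reverse {e} x) = (A.decode x).reverse e := by
  ext f : 2
  by_cases h : f = e
  · subst h
    simp only [decode, reverse, Function.update_self, Network.reverse_apply, Finset.mem_singleton,
      if_true]
    cases x f <;> simp
  · simp [decode, reverse, Network.reverse_apply, h]

variable [DecidableEq V] [Fintype E]

theorem load_network [DecidableEq E] (A : G.Orientation) (x : E → Bool) (v : V) :
    (G.network A).load x v =
      (A.decode x).indegree G.redEdges v + 2 * (A.decode x).indegree G.blueEdges v := by
  simp only [Network.load, indegree, redEdges, blueEdges, Finset.filter_filter, head_decode]
  rw [Finset.card_filter, Finset.card_filter, Finset.mul_sum, ← Finset.sum_add_distrib]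
  refine Finset.sum_congr rfl fun e _ => ?_
  have hw : (G.network A).wt e = G.weight e := rfl
  rw [hw]
  by_cases h : (G.network A).head x e = v <;> rcases G.weight_eq e with hw' | hw' <;> simp [h, hw']

variable [DecidableEq E]

theorem feasible_decode_iff (A : G.Orientation) (x : E → Bool) :
    (A.decode x).Feasible ↔ (G.network A).Feasible x := by
  simp only [Feasible, Network.Feasible, load_network]

theorem Reconfigurable.refl {A : G.Orientation} (h : A.Feasible) : A.Reconfigurable A :=
  ⟨0, fun _ => A, rfl, rfl, fun _ _ => h, fun _ _ => .inl rfl⟩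

theorem Reconfigurable.tail {A B C : G.Orientation} (h : A.Reconfigurable B) (hBC : B.Adjacent C)
    (hC : C.Feasible) : A.Reconfigurable C := by
  obtain ⟨l, S, h0, hl, hf, ha⟩ := h
  refine ⟨l + 1, fun i => if i ≤ l then S i else C, by simpa using h0, by simp, ?_, ?_⟩
  · intro i hi
    by_cases h : i ≤ l
    · simpa [h] using hf i h
    · simpa [h] using hC
  · intro i hi
    by_cases h : i < l
    · simpa [h, h.le, Nat.succ_le_of_lt h] using ha i h
    · obtain rfl : i = l := by omega
      simpa [hl] using hBC

theorem reconfigurable_decode {A : G.Orientation} (hA : A.Feasible) {x : E → Bool}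
    (h : (G.network A).Reach (fun _ => false) x) : A.Reconfigurable (A.decode x) := by
  have h₀ : A.decode (fun _ => false) = A := by
    ext e : 2
    simp [decode]
  have hf₀ : (G.network A).Feasible fun _ => false := by
    rwa [← feasible_decode_iff, h₀]
  induction h with
  | refl =>
    rw [h₀]
    exact .refl hA
  | @tail x y hx hstep ih =>
    have hy := hstep.feasible (Network.Reach.feasible hx hf₀)
    refine ih.tail ?_ ((feasible_decode_iff A y).2 hy)
    obtain ⟨e, -, rfl⟩ := hstep
    exact .inr ⟨e, decode_reverse A x e⟩

-- A loop may be reversed even if its head has no surplus, so it need not give a `Step`. Encoding by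
-- heads makes such reversals invisible.
omit [Fintype E] in
theorem encode_reverse (A B : G.Orientation) (e : E) : A.encode (B.reverse e) = A.encode B ∨
    (A.encode (B.reverse e) = Network.reverse {e} (A.encode B) ∧ (B.arc e).1 ≠ (B.arc e).2) := by
  by_cases h : (B.arc e).1 = (B.arc e).2
  · left
    funext f
    by_cases hf : f = e
    · subst hf
      simp [encode, reverse, h]
    · simp [encode, reverse, Function.update_of_ne hf]
  · refine .inr ⟨?_, h⟩
    funext f
    by_cases hf : f = e
    · subst hf
      rw [Network.reverse_of_mem (Finset.mem_singleton_self f)]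
      have h' : ¬ (B.arc f).2 = (B.arc f).1 := fun hh => h hh.symm
      rcases B.arc_eq_or_eq_swap A f with hA | hA <;> simp [encode, reverse, hA, h, h']
    · simp [encode, reverse, Network.reverse_apply, hf]

/-- Reversals of loops disappear. Any other reversal takes the weight of `e` from its head, and
feasibility afterwards is the surplus that `Step` requires. -/
theorem reach_encode {A B : G.Orientation} (h : A.Reconfigurable B) :
    (G.network A).Reach (fun _ => false) (A.encode B) := by
  obtain ⟨l, S, h0, rfl, hf, ha⟩ := h
  suffices ∀ i ≤ l, (G.network A).Reach (fun _ => false) (A.encode (S i)) from this l le_rfl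
  intro i
  induction i with
  | zero =>
    intro _
    have : A.encode (S 0) = fun _ => false := by
      funext e
      simp [encode, h0]
    rw [this]
  | succ i ih =>
    intro hi
    have hrec := ih (by omega)
    rcases ha i (by omega) with heq | ⟨e, heq⟩
    · rwa [heq]
    · have hfeas := hf (i + 1) hi
      rw [heq] at hfeas ⊢
      rcases A.encode_reverse (S i) e with h | ⟨h, hne⟩
      · rwa [h]
      · rw [h]
        refine hrec.tail ⟨e, ?_, rfl⟩
        have hS := A.decode_encode (S i)
        have hrev : A.decode (Network.reverse {e} (A.encode (S i))) = (S i).reverse e := by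
          rw [decode_reverse, hS]
        rw [← hrev, feasible_decode_iff] at hfeas
        have h₁ := (G.network A).load_reverse_singleton e (A.encode (S i))
          ((G.network A).head (A.encode (S i)) e)
        have h₂ := hfeas ((G.network A).head (A.encode (S i)) e)
        have htail : (G.network A).tail (A.encode (S i)) e ≠
            (G.network A).head (A.encode (S i)) e := by
          have h₃ := A.arc_eq_or_eq_swap (S i) e
          intro hth
          apply hne
          have : (A.arc e).1 = (A.arc e).2 := by
            simp only [Network.tail, Network.head, ConstraintGraph.network] at hth
            cases h₄ : A.encode (S i) e <;> simp [h₄] at hth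
            · exact hth
            · exact hth.symm
          rcases h₃ with h₃ | h₃ <;> simp [h₃, this]
        rw [if_pos rfl, if_neg htail] at h₁
        omega

end ConstraintGraph.Orientation

/-! ### Initialization and total running time -/

theorem setup_spec {N : Network (Fin n) (Fin m)} {s : State} (h00 : s 0 0 = n) (h01 : s 0 1 = m)
    (h1 : ∀ e : Fin m, s 1 e = N.wt e) (h2 : ∀ e : Fin m, s 2 e = N.tl e)
    (h3 : ∀ e : Fin m, s 3 e = N.hd e) :
    Ends Program.setup s (100 * (m + 1)) (fun s' => N.Holds s' ∧ s' 21 0 = m + 1 ∧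
      s' 26 0 = m + 1) := by
  refine (Ends.write_seq (Ends.write_seq ((Ends.for_ (T := 50) (I := fun k s' =>
    ∀ e : Fin m, (e : ℕ) < k → s' 6 (e + e) = N.hd e ∧ s' 6 (e + e + 1) = N.tl e) m (by decide)
    ?_ ?_ ?_ ?_).mono (le_refl _) ?_))).le ?_
  · intro k s s' hs
    simp [hs]
  · intro s' hs
    rw [Expr.eval, hs 0 (by decide) (by decide)]
    simp [Expr.eval, h01]
  · exact fun e he => absurd he (Nat.not_lt_zero _)
  · intro k s' hk hs' hf hI
    have h2k := h2 ⟨k, hk⟩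
    have h3k := h3 ⟨k, hk⟩
    have hf2 := hf 2 (by decide) (by decide)
    have hf3 := hf 3 (by decide) (by decide)
    refine (Ends.write_seq (Ends.write (T := 20) fun e he => ?_)).le (by decide)
    simp only [Expr.eval, ne_eq, Nat.reduceEqDiff, not_false_eq_true, Function.update_self,
      Function.update_of_ne, hs', hf2, hf3] at h2k h3k ⊢
    by_cases hek : (e : ℕ) = k
    · obtain rfl : e = ⟨k, hk⟩ := Fin.ext hek
      simp only [Function.update_self, h2k, and_true]
      rw [Function.update_of_ne (by omega), Function.update_self, h3k]
    · rw [Function.update_of_ne (by omega), Function.update_of_ne (by omega),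
        Function.update_of_ne (by omega), Function.update_of_ne (by omega)]
      exact hI e (by omega)
  · rintro s' ⟨hs', hf⟩
    have hf0 := hf 0 (by decide) (by decide)
    have hf1 := hf 1 (by decide) (by decide)
    simp only [ne_eq, Nat.reduceEqDiff, not_false_eq_true, Function.update_of_ne,
      OfNat.zero_ne_ofNat, OfNat.one_ne_ofNat] at hf0 hf1
    refine ⟨⟨by rw [hf0, h00], by rw [hf0, h01], by rwa [hf1], fun e => (hs' e e.2).1,
      fun e => (hs' e e.2).2⟩, ?_, ?_⟩
    · rw [hf 21 (by decide) (by decide)]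
      simp [Expr.eval, h01]
    · rw [hf 26 (by decide) (by decide)]
      simp [Expr.eval, h01]
  · simp only [Expr.cost]
    omega

/-- With `K = 2 ^ k`, at most `K` entries try `m` edges each, and each try compares with at most `K`
entries. This accounts for `K * K = 2 ^ (2 * k)`; the remaining factors have degree five in `n + m +
2`. -/
theorem solve_spec (G : ConstraintGraph (Fin n) (Fin m)) (A B : G.Orientation) (hA : A.Feasible)
    (hB : B.Feasible) :
    Ends Program.solve (input G A B) (2 ^ (2 * G.blueEdges.card) * (20000 * (n + m + 2) ^ 5))
      (fun s => (A.Reconfigurable B → output s = 1) ∧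
        (¬ A.Reconfigurable B → output s = 0)) := by
  set N := G.network A with hN
  have htable : ∀ (f : Fin m → ℕ) (e : Fin m), table f e = f e := by
    intro f e
    simp [table]
  have hA₀ : N.Feasible fun _ => false := by
    rw [hN, ← ConstraintGraph.Orientation.feasible_decode_iff]
    convert hA
    ext e : 2
    simp [ConstraintGraph.Orientation.decode]
  have hy : N.Feasible (A.encode B) := by
    rwa [hN, ← ConstraintGraph.Orientation.feasible_decode_iff, A.decode_encode]
  have hiff : N.Reach (fun _ => false) (A.encode B) ↔ A.Reconfigurable B := by
    constructor
    · intro h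
      have := ConstraintGraph.Orientation.reconfigurable_decode hA h
      rwa [A.decode_encode] at this
    · exact ConstraintGraph.Orientation.reach_encode
  obtain ⟨K, hK⟩ : ∃ K, K = 2 ^ G.blueEdges.card := ⟨_, rfl⟩
  have hK₁ : 1 ≤ K := hK ▸ Nat.one_le_two_pow
  refine (Ends.seq (setup_spec (N := N) ?_ ?_ ?_ ?_ ?_).frame (fun s₁ hs₁ => Ends.seq
    (explore_spec (x₀ := fun _ => false) (l := [fun _ => false]) (s := s₁) hA₀ ?_ ?_
    (K := K) hK).frame (fun s₂ hs₂ => ?_) (T₂ := 500 * (K + 1) * (m + 1) * (m + 1)))).le ?_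
  · simp [input]
  · simp [input]
  · exact htable _
  · exact htable fun e => ((A.arc e).1 : ℕ)
  · exact htable fun e => ((A.arc e).2 : ℕ)
  · obtain ⟨⟨h, h21, h26⟩, hf⟩ := hs₁
    -- Untouched memory is zero, so the first block already encodes the reference orientation and no
    -- edge is marked.
    have h8 : s₁ 8 = fun _ => 0 := hf 8 (by decide)
    have h9 : s₁ 9 = fun _ => 0 := hf 9 (by decide)
    refine ⟨h, ?_, by simpa using h21, h26, by simp, ?_, List.pairwise_singleton _ _, ?_⟩
    · intro j z hz e
      obtain rfl : (fun _ => false) = z := by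
        have := List.mem_of_getElem? hz
        exact (List.mem_singleton.1 this).symm
      rw [h8]
      rfl
    · intro x hx
      rw [List.mem_singleton.1 hx]
    · intro e he
      rw [h9] at he
      exact absurd rfl he
  · rw [hs₁.2 20 (by decide)]
    rfl
  · obtain ⟨⟨l, h, htried⟩, hf⟩ := hs₂
    have h5 : s₂ 5 = table (fun e => ((B.arc e).2 : ℕ)) := by
      rw [hf 5 (by decide), hs₁.2 5 (by decide)]
      rfl
    have h3 : s₂ 3 = table (fun e => ((A.arc e).2 : ℕ)) := by
      rw [hf 3 (by decide), hs₁.2 3 (by decide)]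
      rfl
    refine (decideTarget_spec hA₀ h htried hy ?_ (hK ▸ h.length_le)).mono le_rfl ?_
    · intro e
      rw [h5, h3, htable, htable, Fin.val_inj]
      simp [ConstraintGraph.Orientation.encode]
    · intro s' hs'
      rwa [hiff] at hs'
  · have hpow : 2 ^ (2 * G.blueEdges.card) = K * K := by
      rw [hK, ← pow_add, two_mul]
    rw [hpow]
    have hm : m + 1 ≤ n + m + 2 := by omega
    have hm' : m ≤ n + m + 2 := by omega
    have hn : n + 2 ≤ n + m + 2 := by omega
    have hr : 1 ≤ n + m + 2 := by omega
    generalize n + m + 2 = r at *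
    have hK₂ : K + 1 ≤ 2 * K := by omega
    have hKK : K ≤ K * K := Nat.le_mul_self K
    have hp : ∀ a i, a ≤ K * K → i ≤ 5 → a * r ^ i ≤ K * K * r ^ 5 := fun a i ha hi =>
      Nat.mul_le_mul ha (Nat.pow_le_pow_right hr hi)
    have h₁ : 100 * (m + 1) ≤ 100 * (K * K * r ^ 5) := by
      have := hp 1 1 (by omega) (by omega)
      rw [one_mul, pow_one] at this
      omega
    have h₂ : K * (m + 1) * (m * (5000 * (K + 1) * (n + 2) * (m + 1) * (m + 1) + 13) + 50) + 6 ≤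
        10069 * (K * K * r ^ 5) := by
      calc K * (m + 1) * (m * (5000 * (K + 1) * (n + 2) * (m + 1) * (m + 1) + 13) + 50) + 6
          ≤ K * r * (r * (5000 * (2 * K) * r * r * r + 13) + 50) + 6 := by gcongr
        _ = 10000 * (K * K * r ^ 5) + 13 * (K * r ^ 2) + 50 * (K * r ^ 1) + 6 * (1 * r ^ 0) := by
          ring
        _ ≤ 10000 * (K * K * r ^ 5) + 13 * (K * K * r ^ 5) + 50 * (K * K * r ^ 5) +
            6 * (K * K * r ^ 5) := by
          gcongr ?_ + 13 * ?_ + 50 * ?_ + 6 * ?_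
          · exact le_rfl
          · exact hp K 2 hKK (by omega)
          · exact hp K 1 hKK (by omega)
          · exact hp 1 0 (by omega) (by omega)
        _ = 10069 * (K * K * r ^ 5) := by ring
    have h₃ : 500 * (K + 1) * (m + 1) * (m + 1) ≤ 1000 * (K * K * r ^ 5) := by
      calc 500 * (K + 1) * (m + 1) * (m + 1) ≤ 500 * (2 * K) * r * r := by gcongr
        _ = 1000 * (K * r ^ 2) := by ring
        _ ≤ 1000 * (K * K * r ^ 5) := Nat.mul_le_mul_left _ (hp K 2 hKK (by omega))
    have h₄ : K * K * (20000 * r ^ 5) = 20000 * (K * K * r ^ 5) := by ring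
    rw [h₄]
    refine (Nat.add_le_add h₁ (Nat.add_le_add h₂ h₃)).trans ?_
    generalize K * K * r ^ 5 = X
    clear * -
    omega

end NCL

theorem theorem5 :
    ∃ (P : NCL.Program) (c : ℕ) (p q : Polynomial ℕ),
      ∀ (n m : ℕ) (G : NCL.ConstraintGraph (Fin n) (Fin m)) (Aini Atar : G.Orientation),
        Aini.Feasible → Atar.Feasible →
        ∃ (t : ℕ) (s : NCL.State),
          NCL.Runs P (NCL.input G Aini Atar) t s ∧
          (Aini.Reconfigurable Atar → NCL.output s = 1) ∧
          (¬ Aini.Reconfigurable Atar → NCL.output s = 0) ∧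
          t ≤ 2 ^ (c * G.blueEdges.card) * p.eval (n + m) ∧
          (Function.Injective G.ends → t ≤ 2 ^ (c * G.blueEdges.card) * q.eval n) := by
  refine ⟨NCL.Program.solve, 2, 20000 * (.X + 2) ^ 5, 20000 * (.X + .X * .X + 2) ^ 5, ?_⟩
  intro n m G Aini Atar hini htar
  obtain ⟨t, s, hr, ht, h₁, h₀⟩ := NCL.solve_spec G Aini Atar hini htar
  refine ⟨t, s, hr, h₁, h₀, ht.trans (le_of_eq ?_), fun hinj => ht.trans ?_⟩
  · simp
  -- Without parallel edges an edge is determined by its arc, an ordered pair of vertices; this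
  -- includes loops.
  · have hm : m ≤ n * n := by
      have : Function.Injective Aini.arc := by
        intro e f hef
        apply hinj
        rw [← Aini.arc_ends e, ← Aini.arc_ends f, hef]
      simpa using Fintype.card_le_of_injective _ this
    have heval : (20000 * (.X + .X * .X + 2) ^ 5 : Polynomial ℕ).eval n =
        20000 * (n + n * n + 2) ^ 5 := by simp
    rw [heval]
    gcongr
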